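/- Let $\{X_t\}_{t\in\mathbb{Z}}$ be a real-valued, possibly non-stationary process on a probability space $(\Omega,\mathcal F,P)$ that is strongly mixing: $\alpha(k)\to 0$ as $k\to\infty$, where $\alpha(k)=\sup\{|P(A\cap B)-P(A)P(B)| : i\in\mathbb{Z},\ A\in\sigma(X_t:t\le i),\ B\in\sigma(X_t:t\ge i+k)\}$. Let $t_m:\mathbb{R}^m\to\mathbb{R}$ $(m\ge 1)$ be (measurable) statistics, $\tau_m>0$ scaling constants and $t(P)\in\mathbb{R}$ a parameter, and let $b=b_n$ be integers with $1\le b_n<n$ ($n\ge 2$). Put $t_n=t_n(X_1,\dots,X_n)$, $T_n=\tau_n(t_n-t(P))$, $F_n(x)=P(T_n\le x)$, $T_{m,i}=\tau_m(t_m(X_i,\dots,X_{i+m-1})-t(P))$, $N_n=n-b+1$, $t_{n,b,i}=t_b(X_i,\dots,X_{i+b-1})$ for $1\le i\le N_n$, and $$S_{n,\mathrm{SUB}}(x)=\frac1{N_n}\sum_{i=1}^{N_n} I\big(\tau_b[t_{n,b,i}-t_n]\le x\big),\qquad m_{n,\mathrm{SUB}}=\frac1{N_n}\sum_{i=1}^{N_n}\tau_b[t_{n,b,i}-t_n],$$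 $$\hat\sigma^2_{n,\mathrm{SUB}}=\frac1{N_n}\sum_{i=1}^{N_n}\big(\tau_b[t_{n,b,i}-t_n]-m_{n,\mathrm{SUB}}\big)^2,\qquad D_{n,b}(x)=\frac1{N_n}\sum_{i=1}^{N_n}P(T_{b,i}\le x).$$ For a positive integer $k_n$, let $C_{n,k_n}(x)$ be the conditional probability, given the data, that $k_n^{-1/2}\sum_{j=1}^{k_n}(Y^*_{n,j}-m_{n,\mathrm{SUB}})\le x$, where $Y^*_{n,1},\dots,Y^*_{n,k_n}$ are iid with distribution function $S_{n,\mathrm{SUB}}$. Let $\Phi$ be the standard normal distribution function and let $\sigma>0$. Suppose that, as $n\to\infty$, 1. $b^{-1}+b/n+\tau_b/\tau_n\to 0$; 2. $T_n=o_p(\tau_n/\tau_b)$, that is, $T_n/(\tau_n/\tau_b)\to 0$ in probability; 3. for each $\epsilon>0$, $\displaystyle\lim_{m\to\infty}\sup_{n\ge m}P\Big(\frac1{N_n}\sum_{i=1}^{N_n}T_{b,i}^2\,I(|T_{b,i}|>m)>\epsilon\Big)=0$; 4. $Y_b\to N(0,\sigma^2)$ in distribution, where $Y_b$, $b=b_n$,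 is a random variable with distribution function $D_{n,b}$. Then, as $n\to\infty$, $$\sup_{x\in\mathbb{R}}|S_{n,\mathrm{SUB}}(x)-\Phi(x/\sigma)|\xrightarrow{p}0\quad\text{and}\quad\hat\sigma^2_{n,\mathrm{SUB}}\xrightarrow{p}\sigma^2,$$ and, for any positive integer sequence $k_n$, $\sup_{x\in\mathbb{R}}|C_{n,k_n}(x)-\Phi(x/\sigma)|\xrightarrow{p}0$. If, in addition, $T_n\to N(0,\sigma^2)$ in distribution, then $$\sup_{x\in\mathbb{R}}|S_{n,\mathrm{SUB}}(x)-F_n(x)|\xrightarrow{p}0\quad\text{and}\quad\sup_{x\in\mathbb{R}}|C_{n,k_n}(x)-F_n(x)|\xrightarrow{p}0\ \text{ for any positive integer sequence }k_n.$$ -/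

import Mathlib

open MeasureTheory ProbabilityTheory Filter Topology
open scoped ENNReal

noncomputable section

namespace Subsampling

variable {Ω : Type*} [MeasurableSpace Ω]

/-- The σ-algebra generated by `X_t`, `t ≤ i`. -/
abbrev pastSigma (X : ℤ → Ω → ℝ) (i : ℤ) : MeasurableSpace Ω :=
  ⨆ t : {t : ℤ // t ≤ i}, MeasurableSpace.comap (X t) inferInstance

/-- The σ-algebra generated by `X_t`, `t ≥ i`. -/
abbrev futureSigma (X : ℤ → Ω → ℝ) (i : ℤ) : MeasurableSpace Ω :=
  ⨆ t : {t : ℤ // i ≤ t}, MeasurableSpace.comap (X t) inferInstance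

/-- The strong mixing coefficient `α(k)`: the supremum of `|P(A ∩ B) - P(A) P(B)|` over all times
`i`, all events `A` of the past up to time `i` and all events `B` of the future from time `i + k`.
The set of values is non-empty and bounded by `1` for a probability measure. -/
def alphaMixing (μ : Measure Ω) (X : ℤ → Ω → ℝ) (k : ℕ) : ℝ :=
  sSup {r : ℝ | ∃ (i : ℤ) (A B : Set Ω), MeasurableSet[pastSigma X i] A ∧
    MeasurableSet[futureSigma X (i + k)] B ∧ r = |μ.real (A ∩ B) - μ.real A * μ.real B|}

/-- Strong mixing (α-mixing). -/
def StronglyMixing (μ : Measure Ω) (X : ℤ → Ω → ℝ) : Prop :=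
  Tendsto (alphaMixing μ X) atTop (𝓝 0)

/-- The data block `(X_i, …, X_{i+m-1})`. -/
def block (X : ℤ → Ω → ℝ) (m i : ℕ) (ω : Ω) : Fin m → ℝ :=
  fun j => X ((i : ℤ) + (j : ℕ)) ω

/-- `T_{m,i} = τ_m (t_m(X_i, …, X_{i+m-1}) - θ)`, where `θ` is the target parameter `t(P)`. -/
def blockRoot (X : ℤ → Ω → ℝ) (t : ∀ m : ℕ, (Fin m → ℝ) → ℝ) (τ : ℕ → ℝ) (θ : ℝ)
    (m i : ℕ) (ω : Ω) : ℝ :=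
  τ m * (t m (block X m i ω) - θ)

/-- `T_n = τ_n (t_n(X_1, …, X_n) - θ)`. -/
def root (X : ℤ → Ω → ℝ) (t : ∀ m : ℕ, (Fin m → ℝ) → ℝ) (τ : ℕ → ℝ) (θ : ℝ)
    (n : ℕ) (ω : Ω) : ℝ :=
  blockRoot X t τ θ n 1 ω

/-- `F_n(x) = P(T_n ≤ x)`. -/
def rootDist (μ : Measure Ω) (X : ℤ → Ω → ℝ) (t : ∀ m : ℕ, (Fin m → ℝ) → ℝ) (τ : ℕ → ℝ)
    (θ : ℝ) (n : ℕ) (x : ℝ) : ℝ :=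
  μ.real {ω | root X t τ θ n ω ≤ x}

/-- `N_n = n - b + 1`, the number of overlapping blocks of length `b` (used for `b < n`). -/
def numBlocks (n b : ℕ) : ℕ := n - b + 1

/-- `τ_b (t_{n,b,i} - t_n)`, with `t_{n,b,i} = t_b(X_i, …, X_{i+b-1})`, `t_n = t_n(X_1, …, X_n)`. -/
def subStat (X : ℤ → Ω → ℝ) (t : ∀ m : ℕ, (Fin m → ℝ) → ℝ) (τ : ℕ → ℝ)
    (n b i : ℕ) (ω : Ω) : ℝ :=
  τ b * (t b (block X b i ω) - t n (block X n 1 ω))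

open Classical in
/-- The subsampling distribution function `S_{n,SUB}(x)`. -/
def subDist (X : ℤ → Ω → ℝ) (t : ∀ m : ℕ, (Fin m → ℝ) → ℝ) (τ : ℕ → ℝ)
    (n b : ℕ) (x : ℝ) (ω : Ω) : ℝ :=
  (numBlocks n b : ℝ)⁻¹ *
    ∑ i ∈ Finset.Icc 1 (numBlocks n b), if subStat X t τ n b i ω ≤ x then (1 : ℝ) else 0

/-- The mean `m_{n,SUB}` of the subsampling distribution. -/
def subMean (X : ℤ → Ω → ℝ) (t : ∀ m : ℕ, (Fin m → ℝ) → ℝ) (τ : ℕ → ℝ)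
    (n b : ℕ) (ω : Ω) : ℝ :=
  (numBlocks n b : ℝ)⁻¹ * ∑ i ∈ Finset.Icc 1 (numBlocks n b), subStat X t τ n b i ω

/-- The subsampling variance, that is, the variance of the subsampling distribution. -/
def subVar (X : ℤ → Ω → ℝ) (t : ∀ m : ℕ, (Fin m → ℝ) → ℝ) (τ : ℕ → ℝ)
    (n b : ℕ) (ω : Ω) : ℝ :=
  (numBlocks n b : ℝ)⁻¹ *
    ∑ i ∈ Finset.Icc 1 (numBlocks n b), (subStat X t τ n b i ω - subMean X t τ n b ω) ^ 2

/-- The probability measure on `ℝ` with distribution function `S_{n,SUB}`, given the data: the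
empirical measure of the subsample statistics. -/
def subLaw (X : ℤ → Ω → ℝ) (t : ∀ m : ℕ, (Fin m → ℝ) → ℝ) (τ : ℕ → ℝ)
    (n b : ℕ) (ω : Ω) : Measure ℝ :=
  (numBlocks n b : ℝ≥0∞)⁻¹ •
    ∑ i ∈ Finset.Icc 1 (numBlocks n b), Measure.dirac (subStat X t τ n b i ω)

/-- The convolved subsampling distribution function `C_{n,k}(x)`: given the data, the probability
that `k^{-1/2} ∑_{j ≤ k} (Y*_j - m_{n,SUB}) ≤ x`, where `Y*_1, …, Y*_k` are iid with distribution
`S_{n,SUB}` (their joint law is the `k`-fold product measure). -/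
def convDist (X : ℤ → Ω → ℝ) (t : ∀ m : ℕ, (Fin m → ℝ) → ℝ) (τ : ℕ → ℝ)
    (n b k : ℕ) (x : ℝ) (ω : Ω) : ℝ :=
  (Measure.pi (fun _ : Fin k => subLaw X t τ n b ω)).real
    {y | (Real.sqrt k)⁻¹ * ∑ j, (y j - subMean X t τ n b ω) ≤ x}

/-- `D_{n,b}(x) = N_n⁻¹ ∑_i P(T_{b,i} ≤ x)`. -/
def avgDist (μ : Measure Ω) (X : ℤ → Ω → ℝ) (t : ∀ m : ℕ, (Fin m → ℝ) → ℝ) (τ : ℕ → ℝ)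
    (θ : ℝ) (n b : ℕ) (x : ℝ) : ℝ :=
  (numBlocks n b : ℝ)⁻¹ *
    ∑ i ∈ Finset.Icc 1 (numBlocks n b), μ.real {ω | blockRoot X t τ θ b i ω ≤ x}

open Classical in
/-- `N_n⁻¹ ∑_i T_{b,i}² I(|T_{b,i}| > m)`. -/
def truncSecondMoment (X : ℤ → Ω → ℝ) (t : ∀ m : ℕ, (Fin m → ℝ) → ℝ) (τ : ℕ → ℝ)
    (θ : ℝ) (n b m : ℕ) (ω : Ω) : ℝ :=
  (numBlocks n b : ℝ)⁻¹ * ∑ i ∈ Finset.Icc 1 (numBlocks n b),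
    if (m : ℝ) < |blockRoot X t τ θ b i ω| then blockRoot X t τ θ b i ω ^ 2 else 0

/-- The standard normal distribution function `Φ`. -/
def stdNormalCDF (x : ℝ) : ℝ := cdf (gaussianReal 0 1) x

end Subsampling

end

namespace Subsampling

/-! Each subsample statistic is `T_{b,i} - U` with `U = τ_b (t_n - θ)`, and `U` tends to 0 in
probability. For fixed `x`, the empirical distribution function of the `T_{b,i}` has mean
`D_{n,b}(x)` and, by mixing, variance at most `2(b+K)/N_n + α(K)` for every gap `K`; Chebyshev and
the limit of `D_{n,b}` give its limit. Shifting by `U` and Pólya's theorem yield uniform convergence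
(`withHighProb_subDist`). With the truncated second moment condition, the second moment of the
subsampling law converges too (`withHighProb_second_moment`).

The rest is deterministic. `exists_forall_normalizedSumLaw_close` shows that a law close to `N(0,
v)` in distribution function and second moment has small mean and normalized iid sums close to `N(0,
v)`, uniformly in the number `k` of summands. The key is `k |φ_ν(s/√k) - φ_γ(s/√k)| → 0` for
arbitrary `k` (`tendsto_mul_norm_charFun_sub`): finitely many small `k` follow from weak
convergence, large `k` from a second-order Taylor expansion. A centred Gaussian is stable under
normalized sums, so `k` need not grow. Explicit tolerances allow these facts to be applied for each
outcome on an event of high probability, without subsequences. -/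

/-! ### Weak convergence and distribution functions on the line. -/

lemma tendsto_of_tendsto_measureReal_Iic {ι : Type*} {l : Filter ι} [l.IsCountablyGenerated]
    {ν : ι → ProbabilityMeasure ℝ} {γ : ProbabilityMeasure ℝ}
    (h : ∀ x, Tendsto (fun j => (ν j : Measure ℝ).real (Set.Iic x)) l
      (𝓝 ((γ : Measure ℝ).real (Set.Iic x)))) :
    Tendsto ν l (𝓝 γ) := by
  have hIoc : ∀ (ρ : ProbabilityMeasure ℝ) (a b : ℝ), a ≤ b →
      (ρ : Measure ℝ).real (Set.Ioc a b)
        = (ρ : Measure ℝ).real (Set.Iic b) - (ρ : Measure ℝ).real (Set.Iic a) := by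
    intro ρ a b hab
    have : Set.Ioc a b = Set.Iic b \ Set.Iic a := by
      ext y; simp [and_comm]
    rw [this, measureReal_sdiff (Set.Iic_subset_Iic.2 hab) measurableSet_Iic]
  -- Half-open intervals form a π-system containing arbitrarily small neighbourhoods of each point,
  -- and their masses are increments of the distribution function.
  refine IsPiSystem.tendsto_probabilityMeasure_of_tendsto_of_mem
    (S := Set.range fun p : ℝ × ℝ => Set.Ioc p.1 p.2) ?_ ?_ ?_ ?_
  · rintro _ ⟨p, rfl⟩ _ ⟨q, rfl⟩ -
    exact ⟨(p.1 ⊔ q.1, p.2 ⊓ q.2), Set.Ioc_inter_Ioc.symm⟩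
  · rintro _ ⟨p, rfl⟩
    exact measurableSet_Ioc
  · intro u hu x hx
    obtain ⟨ε, hε, hball⟩ := Metric.isOpen_iff.1 hu x hx
    refine ⟨_, ⟨(x - ε / 2, x + ε / 2), rfl⟩, Ioc_mem_nhds (by linarith) (by linarith), ?_⟩
    refine subset_trans ?_ hball
    intro y hy
    rw [Real.ball_eq_Ioo]
    exact ⟨by linarith [hy.1], by linarith [hy.2]⟩
  · rintro _ ⟨⟨a, b⟩, rfl⟩
    rw [← NNReal.tendsto_coe]
    change Tendsto (fun i => (ν i : Measure ℝ).real (Set.Ioc a b)) l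
      (𝓝 ((γ : Measure ℝ).real (Set.Ioc a b)))
    rcases le_total a b with hab | hab
    · simp_rw [hIoc _ a b hab]
      exact (h b).sub (h a)
    · simpa [Set.Ioc_eq_empty_of_le hab] using tendsto_const_nhds

lemma tendsto_measureReal_Iic_of_tendsto {ι : Type*} {l : Filter ι}
    {ν : ι → ProbabilityMeasure ℝ} {γ : ProbabilityMeasure ℝ} (h : Tendsto ν l (𝓝 γ)) (x : ℝ)
    (hx : (γ : Measure ℝ) {x} = 0) :
    Tendsto (fun j => (ν j : Measure ℝ).real (Set.Iic x)) l
      (𝓝 ((γ : Measure ℝ).real (Set.Iic x))) := by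
  have := ProbabilityMeasure.tendsto_measure_of_null_frontier_of_tendsto' h (E := Set.Iic x)
    (by rwa [frontier_Iic])
  exact (ENNReal.tendsto_toReal (measure_ne_top _ _)).comp this

/-- **Pólya's theorem**, in finitary form. -/
lemma exists_finset_forall_abs_sub_le {G : ℝ → ℝ} (hG : Monotone G) (hc : Continuous G)
    (h0 : Tendsto G atBot (𝓝 0)) (h1 : Tendsto G atTop (𝓝 1)) {ε : ℝ} (hε : 0 < ε) :
    ∃ A : Finset ℝ, ∀ F : ℝ → ℝ, Monotone F → (∀ x, 0 ≤ F x) → (∀ x, F x ≤ 1) →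
      (∀ a ∈ A, |F a - G a| ≤ ε / 2) → ∀ x, |F x - G x| ≤ ε := by
  classical
  obtain ⟨p, hp⟩ := (h0.eventually (gt_mem_nhds (half_pos hε))).exists
  obtain ⟨q, hq⟩ := (h1.eventually (lt_mem_nhds (show 1 - ε / 2 < 1 by linarith))).exists
  have hG0 : ∀ x, 0 ≤ G x := fun x => hG.le_of_tendsto h0 x
  have hG1 : ∀ x, G x ≤ 1 := fun x => hG.ge_of_tendsto h1 x
  have hab : ∀ x, ∃ a b, a < x ∧ x < b ∧ G b - G a < ε / 2 := by
    intro x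
    obtain ⟨δ, hδ, h⟩ := Metric.continuousAt_iff.1 (hc.continuousAt (x := x)) (ε / 4) (by linarith)
    refine ⟨x - δ / 2, x + δ / 2, by linarith, by linarith, ?_⟩
    have e1 := h (x := x - δ / 2) (by rw [Real.dist_eq, abs_lt]; constructor <;> linarith)
    have e2 := h (x := x + δ / 2) (by rw [Real.dist_eq, abs_lt]; constructor <;> linarith)
    rw [Real.dist_eq, abs_lt] at e1 e2
    linarith
  choose a b ha hb hGab using hab
  obtain ⟨s, hs⟩ := (isCompact_Icc (a := p) (b := q)).elim_finite_subcover
    (fun x => Set.Ioo (a x) (b x)) (fun _ => isOpen_Ioo)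
    (fun x _ => Set.mem_iUnion.2 ⟨x, ha x, hb x⟩)
  -- The points `p` and `q` control the tails. On `[p, q]`, monotonicity squeezes `F x` between its
  -- values at the ends of a covering interval, across which `G` varies by less than `ε / 2`.
  refine ⟨insert p (insert q (s.image a ∪ s.image b)), fun F hF F0 F1 hA x => ?_⟩
  have hFp := abs_le.1 (hA p (by simp))
  have hFq := abs_le.1 (hA q (by simp))
  rw [abs_le]
  rcases le_total x p with hx | hx
  · have := hF hx; have := hG hx; have := F0 x; have := hG0 x
    constructor <;> linarith
  rcases le_total q x with hx' | hx'
  · have := hF hx'; have := hG hx'; have := F1 x; have := hG1 x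
    constructor <;> linarith
  obtain ⟨i, hi, hxi⟩ := Set.mem_iUnion₂.1 (hs ⟨hx, hx'⟩)
  have e1 := abs_le.1 (hA (a i) (Finset.mem_insert_of_mem (Finset.mem_insert_of_mem
    (Finset.mem_union_left _ (Finset.mem_image_of_mem a hi)))))
  have e2 := abs_le.1 (hA (b i) (Finset.mem_insert_of_mem (Finset.mem_insert_of_mem
    (Finset.mem_union_right _ (Finset.mem_image_of_mem b hi)))))
  have := hF hxi.1.le; have := hF hxi.2.le; have := hG hxi.1.le; have := hG hxi.2.le
  have := hGab i
  constructor <;> linarith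

lemma continuous_measureReal_Iic (γ : Measure ℝ) [IsProbabilityMeasure γ]
    (hγ : ∀ x, γ {x} = 0) : Continuous fun x => γ.real (Set.Iic x) := by
  have h : (fun x => γ.real (Set.Iic x)) = cdf γ := funext fun x => (cdf_eq_real γ x).symm
  rw [h, continuous_iff_continuousAt]
  intro x
  have := (cdf γ).measure_singleton x
  rw [measure_cdf, hγ, eq_comm, ENNReal.ofReal_eq_zero, sub_nonpos] at this
  rw [continuousAt_iff_continuous_left_right, ← continuousWithinAt_Iio_iff_Iic]
  refine ⟨?_, (cdf γ).right_continuous x⟩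
  rw [(cdf γ).mono.continuousWithinAt_Iio_iff_leftLim_eq]
  exact le_antisymm ((cdf γ).mono.leftLim_le le_rfl) this

lemma exists_finset_forall_abs_measureReal_Iic_sub_le (γ : Measure ℝ) [IsProbabilityMeasure γ]
    (hγ : ∀ x, γ {x} = 0) {ε : ℝ} (hε : 0 < ε) :
    ∃ A : Finset ℝ, ∀ F : ℝ → ℝ, Monotone F → (∀ x, 0 ≤ F x) → (∀ x, F x ≤ 1) →
      (∀ a ∈ A, |F a - γ.real (Set.Iic a)| ≤ ε / 2) → ∀ x, |F x - γ.real (Set.Iic x)| ≤ ε := by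
  have h : (fun x => γ.real (Set.Iic x)) = cdf γ := funext fun x => (cdf_eq_real γ x).symm
  refine exists_finset_forall_abs_sub_le (G := fun x => γ.real (Set.Iic x)) ?_
    (continuous_measureReal_Iic γ hγ) ?_ ?_ hε
  · rw [h]; exact monotone_cdf γ
  · rw [h]; exact tendsto_cdf_atBot γ
  · rw [h]; exact tendsto_cdf_atTop γ

/-- A consequence of Fatou's lemma for weak convergence. -/
lemma eventually_integral_sub_lt {ν : ℕ → ProbabilityMeasure ℝ} {γ : ProbabilityMeasure ℝ}
    (h : Tendsto ν atTop (𝓝 γ)) {f : ℝ → ℝ} (hf : Continuous f) (hf0 : 0 ≤ f)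
    (hν : ∀ j, Integrable f (ν j : Measure ℝ)) (hγ : Integrable f (γ : Measure ℝ))
    {ε : ℝ} (hε : 0 < ε) :
    ∀ᶠ j in atTop, ∫ y, f y ∂(γ : Measure ℝ) - ε < ∫ y, f y ∂(ν j : Measure ℝ) := by
  have key := lintegral_le_liminf_lintegral_of_forall_isOpen_measure_le_liminf_measure
    (μ := (γ : Measure ℝ)) (μs := fun j => (ν j : Measure ℝ)) hf hf0
    (fun G hG => ProbabilityMeasure.le_liminf_measure_open_of_tendsto h hG)
  rw [← ofReal_integral_eq_lintegral_ofReal hγ (ae_of_all _ hf0)] at key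
  rcases le_or_gt (∫ y, f y ∂(γ : Measure ℝ)) 0 with h0 | h0
  · refine Eventually.of_forall fun j => ?_
    have : 0 ≤ ∫ y, f y ∂(ν j : Measure ℝ) := integral_nonneg hf0
    linarith
  · have hlt : ENNReal.ofReal (∫ y, f y ∂(γ : Measure ℝ) - ε)
        < atTop.liminf fun j => ∫⁻ y, ENNReal.ofReal (f y) ∂(ν j : Measure ℝ) :=
      lt_of_lt_of_le ((ENNReal.ofReal_lt_ofReal_iff h0).2 (by linarith)) key
    filter_upwards [eventually_lt_of_lt_liminf hlt] with j hj
    rw [← ofReal_integral_eq_lintegral_ofReal (hν j) (ae_of_all _ hf0)] at hj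
    exact ENNReal.ofReal_lt_ofReal_iff'.1 hj |>.1

/-- Pratt's argument: Fatou applied to `g - f` and to `g + f`, both nonnegative, bounds the integral
of `f` from both sides once the integrals of `g` converge. -/
lemma tendsto_integral_of_abs_le {ν : ℕ → ProbabilityMeasure ℝ} {γ : ProbabilityMeasure ℝ}
    (h : Tendsto ν atTop (𝓝 γ)) {f g : ℝ → ℝ} (hf : Continuous f) (hg : Continuous g)
    (hfg : ∀ y, |f y| ≤ g y)
    (hν : ∀ j, Integrable g (ν j : Measure ℝ)) (hγ : Integrable g (γ : Measure ℝ))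
    (hlim : Tendsto (fun j => ∫ y, g y ∂(ν j : Measure ℝ)) atTop (𝓝 (∫ y, g y ∂(γ : Measure ℝ)))) :
    Tendsto (fun j => ∫ y, f y ∂(ν j : Measure ℝ)) atTop (𝓝 (∫ y, f y ∂(γ : Measure ℝ))) := by
  have hi : ∀ ρ : ProbabilityMeasure ℝ, Integrable g (ρ : Measure ℝ) →
      Integrable f (ρ : Measure ℝ) := fun ρ hρ =>
    hρ.mono' hf.aestronglyMeasurable (ae_of_all _ hfg)
  rw [Metric.tendsto_nhds]
  intro ε hε
  have e1 := eventually_integral_sub_lt h (hg.sub hf)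
    (fun y => by have := abs_le.1 (hfg y); simp only [Pi.zero_apply, Pi.sub_apply]; linarith)
    (fun j => (hν j).sub (hi _ (hν j))) (hγ.sub (hi _ hγ)) (half_pos hε)
  have e2 := eventually_integral_sub_lt h (hg.add hf)
    (fun y => by have := abs_le.1 (hfg y); simp only [Pi.zero_apply, Pi.add_apply]; linarith)
    (fun j => (hν j).add (hi _ (hν j))) (hγ.add (hi _ hγ)) (half_pos hε)
  filter_upwards [e1, e2, Metric.tendsto_nhds.1 hlim _ (half_pos hε)] with j h1 h2 h3
  rw [integral_sub' hγ (hi _ hγ), integral_sub' (hν j) (hi _ (hν j))] at h1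
  rw [integral_add' hγ (hi _ hγ), integral_add' (hν j) (hi _ (hν j))] at h2
  rw [Real.dist_eq, abs_lt] at h3 ⊢
  constructor <;> linarith

/-! ### Characteristic functions and a central limit theorem uniform in the number of summands. -/

/-- Taylor's bound serves for `|x| ≤ 1`, the triangle inequality otherwise. The quadratic branch
keeps the remainder integrable under second moments only; the cubic one makes it small. -/
lemma norm_exp_mul_I_sub_taylor_two_le (x : ℝ) :
    ‖Complex.exp (x * Complex.I) - (1 + x * Complex.I - x ^ 2 / 2)‖
      ≤ 4 * min (x ^ 2) (|x| ^ 3) := by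
  rcases le_total |x| 1 with hx | hx
  · have hn : ‖(x : ℂ) * Complex.I‖ = |x| := by simp
    have := Complex.exp_bound (x := x * Complex.I) (by rwa [hn]) (n := 3) (by norm_num)
    rw [hn] at this
    have e : ∑ m ∈ Finset.range 3, ((x : ℂ) * Complex.I) ^ m / (m.factorial : ℂ)
        = 1 + x * Complex.I - x ^ 2 / 2 := by
      simp [Finset.sum_range_succ, mul_pow, Nat.factorial]
      ring
    rw [e] at this
    have h0 := abs_nonneg x
    have h3 : |x| ^ 3 ≤ x ^ 2 := by rw [← sq_abs]; nlinarith [sq_nonneg |x|]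
    rw [min_eq_right h3]
    refine this.trans ?_
    have h3' : (0 : ℝ) ≤ |x| ^ 3 := by positivity
    norm_num [Nat.factorial]
    linarith
  · have h3 : x ^ 2 ≤ |x| ^ 3 := by rw [← sq_abs]; nlinarith [sq_nonneg |x|]
    rw [min_eq_left h3]
    have e1 : ‖Complex.exp (x * Complex.I)‖ = 1 := Complex.norm_exp_ofReal_mul_I x
    have e2 : ‖(x : ℂ) * Complex.I‖ = |x| := by simp
    have e3 : ‖(x : ℂ) ^ 2 / 2‖ = x ^ 2 / 2 := by simp
    calc _ ≤ ‖Complex.exp (x * Complex.I)‖ + ‖1 + (x : ℂ) * Complex.I - x ^ 2 / 2‖ :=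
          norm_sub_le _ _
      _ ≤ 1 + ((1 + |x|) + x ^ 2 / 2) := by
          rw [e1]
          gcongr
          refine (norm_sub_le _ _).trans ?_
          rw [e3]
          gcongr
          refine (norm_add_le _ _).trans ?_
          rw [e2, norm_one]
      _ ≤ 4 * x ^ 2 := by rw [← sq_abs x]; nlinarith

lemma integrable_min_sq {ρ : Measure ℝ} (h2 : Integrable (fun y => y ^ 2) ρ) {c : ℝ} (hc : 0 ≤ c) :
    Integrable (fun y => min (y ^ 2) (c * |y| ^ 3)) ρ := by
  refine h2.mono' (by fun_prop) (ae_of_all _ fun y => ?_)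
  rw [Real.norm_of_nonneg (by positivity)]
  exact min_le_left _ _

lemma integrable_id_of_sq {ρ : Measure ℝ} [IsFiniteMeasure ρ]
    (h2 : Integrable (fun y => y ^ 2) ρ) : Integrable (fun y => y) ρ := by
  refine ((integrable_const (1 : ℝ)).add h2).mono' (by fun_prop) (ae_of_all _ fun y => ?_)
  simp only [Pi.add_apply, Real.norm_eq_abs]
  rw [← sq_abs]
  nlinarith [sq_nonneg (|y| - 1)]

/-- Centring kills the linear term. The factor `u ^ 2` is pulled out because `k * u ^ 2 = s ^ 2`
when `u = s / √k`. -/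
lemma norm_charFun_sub_taylor_two_le {ρ : Measure ℝ} [IsProbabilityMeasure ρ]
    (h2 : Integrable (fun y => y ^ 2) ρ) (h1 : ∫ y, y ∂ρ = 0) (u : ℝ) :
    ‖charFun ρ u - (1 - ((∫ y, y ^ 2 ∂ρ : ℝ) : ℂ) * u ^ 2 / 2)‖
      ≤ 4 * u ^ 2 * ∫ y, min (y ^ 2) (|u| * |y| ^ 3) ∂ρ := by
  have hi1 := integrable_id_of_sq h2
  have hexp : Integrable (fun y : ℝ => Complex.exp (u * y * Complex.I)) ρ := by
    refine (integrable_const (1 : ℝ)).mono' (by fun_prop) (ae_of_all _ fun y => ?_)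
    rw [← Complex.ofReal_mul, Complex.norm_exp_ofReal_mul_I]
  have hlin : Integrable (fun y : ℝ => (1 : ℂ) + ((u * y : ℝ) : ℂ) * Complex.I) ρ :=
    (integrable_const _).add (((hi1.const_mul u).ofReal).mul_const _)
  have hquad : Integrable (fun y : ℝ => ((u ^ 2 / 2 * y ^ 2 : ℝ) : ℂ)) ρ :=
    (h2.const_mul _).ofReal
  have e : (1 - ((∫ y, y ^ 2 ∂ρ : ℝ) : ℂ) * u ^ 2 / 2)
      = ∫ y : ℝ, ((1 : ℂ) + ((u * y : ℝ) : ℂ) * Complex.I - ((u ^ 2 / 2 * y ^ 2 : ℝ) : ℂ)) ∂ρ := by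
    rw [integral_sub hlin hquad, integral_add (integrable_const _)
      (((hi1.const_mul u).ofReal).mul_const _), integral_mul_const,
      integral_complex_ofReal, integral_complex_ofReal, integral_const_mul, integral_const_mul, h1]
    simp
    ring
  have hd : Integrable (fun y : ℝ => (1 : ℂ) + ((u * y : ℝ) : ℂ) * Complex.I
      - ((u ^ 2 / 2 * y ^ 2 : ℝ) : ℂ)) ρ := hlin.sub hquad
  rw [charFun_apply_real, e, ← integral_sub hexp hd, ← integral_const_mul]
  refine norm_integral_le_of_norm_le ((integrable_min_sq h2 (abs_nonneg u)).const_mul _)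
    (ae_of_all _ fun y => ?_)
  have := norm_exp_mul_I_sub_taylor_two_le (u * y)
  convert this using 1
  · push_cast
    ring_nf
  · rw [mul_assoc, mul_min_of_nonneg _ _ (sq_nonneg u), abs_mul, mul_pow, mul_pow, ← sq_abs u]
    ring_nf

lemma norm_pow_sub_pow_le_of_norm_le_one {a b : ℂ} (ha : ‖a‖ ≤ 1) (hb : ‖b‖ ≤ 1) (n : ℕ) :
    ‖a ^ n - b ^ n‖ ≤ n * ‖a - b‖ := by
  induction n with
  | zero => simp
  | succ n ih =>
    have e : a ^ (n + 1) - b ^ (n + 1) = a ^ n * (a - b) + (a ^ n - b ^ n) * b := by ring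
    rw [e]
    refine (norm_add_le _ _).trans ?_
    rw [norm_mul, norm_mul, norm_pow]
    have h1 : ‖a‖ ^ n ≤ 1 := pow_le_one₀ (norm_nonneg _) ha
    have := mul_le_mul_of_nonneg_right h1 (norm_nonneg (a - b))
    have := mul_le_mul_of_nonneg_left hb (norm_nonneg (a ^ n - b ^ n))
    push_cast
    linarith

lemma tendsto_integral_min_sq {ρ : Measure ℝ} (h2 : Integrable (fun y => y ^ 2) ρ) (s : ℝ) :
    Tendsto (fun K : ℕ => ∫ y, min (y ^ 2) (|s| / √K * |y| ^ 3) ∂ρ) atTop (𝓝 0) := by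
  have hc : Tendsto (fun K : ℕ => |s| / √K) atTop (𝓝 0) :=
    tendsto_const_nhds.div_atTop (Real.tendsto_sqrt_atTop.comp tendsto_natCast_atTop_atTop)
  rw [← integral_zero ℝ ℝ (μ := ρ)]
  refine tendsto_integral_of_dominated_convergence (fun y => y ^ 2) (fun K => by fun_prop) h2
    (fun K => ae_of_all _ fun y => ?_) (ae_of_all _ fun y => ?_)
  · rw [Real.norm_of_nonneg (by positivity)]
    exact min_le_left _ _
  · refine squeeze_zero (fun K => by positivity) (fun K => min_le_right _ _) ?_
    simpa using hc.mul_const (|y| ^ 3)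

lemma tendsto_mul_norm_charFun_sub {ν : ℕ → ProbabilityMeasure ℝ} {γ : ProbabilityMeasure ℝ}
    (h : Tendsto ν atTop (𝓝 γ))
    (hν : ∀ j, Integrable (fun y => y ^ 2) (ν j : Measure ℝ))
    (hγ : Integrable (fun y => y ^ 2) (γ : Measure ℝ))
    (hν0 : ∀ j, ∫ y, y ∂(ν j : Measure ℝ) = 0) (hγ0 : ∫ y, y ∂(γ : Measure ℝ) = 0)
    (hlim : Tendsto (fun j => ∫ y, y ^ 2 ∂(ν j : Measure ℝ)) atTop
      (𝓝 (∫ y, y ^ 2 ∂(γ : Measure ℝ))))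
    {k : ℕ → ℕ} (hk : ∀ j, 1 ≤ k j) (s : ℝ) :
    Tendsto (fun j => (k j : ℝ) *
      ‖charFun (ν j : Measure ℝ) (s / √(k j)) - charFun (γ : Measure ℝ) (s / √(k j))‖)
      atTop (𝓝 0) := by
  rw [Metric.tendsto_nhds]
  intro ε hε
  -- Replacing `k` by the threshold `K ≤ k` inside the integral makes the remainder bound uniform in
  -- `k`.
  have hR : ∀ (ρ : ProbabilityMeasure ℝ), Integrable (fun y => y ^ 2) (ρ : Measure ℝ) →
      ∫ y, y ∂(ρ : Measure ℝ) = 0 → ∀ K k : ℕ, 1 ≤ K → K ≤ k →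
      (k : ℝ) * ‖charFun (ρ : Measure ℝ) (s / √k)
        - (1 - ((∫ y, y ^ 2 ∂(ρ : Measure ℝ) : ℝ) : ℂ) * ((s / √k : ℝ) : ℂ) ^ 2 / 2)‖
        ≤ 4 * s ^ 2 * ∫ y, min (y ^ 2) (|s| / √K * |y| ^ 3) ∂(ρ : Measure ℝ) := by
    intro ρ h2 h1 K k hK hKk
    have hKp : (0 : ℝ) < K := by exact_mod_cast hK
    have hkp : (0 : ℝ) < k := by exact_mod_cast hK.trans hKk
    have hsq : (s / √(k : ℝ)) ^ 2 = s ^ 2 / k := by rw [div_pow, Real.sq_sqrt hkp.le]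
    have hle : |s / √(k : ℝ)| ≤ |s| / √(K : ℝ) := by
      rw [abs_div, abs_of_nonneg (Real.sqrt_nonneg _)]
      have : √(K : ℝ) ≤ √(k : ℝ) := Real.sqrt_le_sqrt (by exact_mod_cast hKk)
      have : 0 < √(K : ℝ) := Real.sqrt_pos.2 hKp
      gcongr
    calc _ ≤ (k : ℝ) * (4 * (s / √k) ^ 2
            * ∫ y, min (y ^ 2) (|s / √(k : ℝ)| * |y| ^ 3) ∂(ρ : Measure ℝ)) := by
          gcongr
          exact norm_charFun_sub_taylor_two_le h2 h1 _
      _ = 4 * s ^ 2 * ∫ y, min (y ^ 2) (|s / √(k : ℝ)| * |y| ^ 3) ∂(ρ : Measure ℝ) := by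
          rw [hsq]; field_simp
      _ ≤ _ := by
          gcongr
          · exact integrable_min_sq h2 (abs_nonneg _)
          · exact integrable_min_sq h2 (by positivity)
          · intro y
            dsimp only
            gcongr
  have hsmall := (tendsto_integral_min_sq hγ s).const_mul (4 * s ^ 2)
  rw [mul_zero] at hsmall
  -- `K` is chosen from the limit law alone; the bound passes to `ν j` below because its integrand
  -- is dominated by `y ^ 2`, whose integrals converge.
  obtain ⟨K, hK, hK1⟩ := ((hsmall.eventually (gt_mem_nhds (show 0 < ε / 4 by linarith))).and
    (eventually_ge_atTop 1)).exists
  have hbig : ∀ᶠ j in atTop, 4 * s ^ 2 *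
      ∫ y, min (y ^ 2) (|s| / √K * |y| ^ 3) ∂(ν j : Measure ℝ) < ε / 4 := by
    have := (tendsto_integral_of_abs_le h (f := fun y => min (y ^ 2) (|s| / √K * |y| ^ 3))
      (g := fun y => y ^ 2) (by fun_prop) (by fun_prop)
      (fun y => by rw [abs_of_nonneg (by positivity)]; exact min_le_left _ _) hν hγ hlim).const_mul
      (4 * s ^ 2)
    exact this.eventually (gt_mem_nhds hK)
  have hvar : ∀ᶠ j in atTop, s ^ 2 / 2 *
      |∫ y, y ^ 2 ∂(ν j : Measure ℝ) - ∫ y, y ^ 2 ∂(γ : Measure ℝ)| < ε / 4 := by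
    have := ((hlim.sub_const (∫ y, y ^ 2 ∂(γ : Measure ℝ))).abs).const_mul (s ^ 2 / 2)
    rw [sub_self, abs_zero, mul_zero] at this
    exact this.eventually (gt_mem_nhds (by linarith))
  have hfin : ∀ᶠ j in atTop, ∀ q ∈ Finset.range K, (q : ℝ) *
      ‖charFun (ν j : Measure ℝ) (s / √q) - charFun (γ : Measure ℝ) (s / √q)‖ < ε := by
    rw [eventually_all_finset]
    intro q _
    have := (((ProbabilityMeasure.tendsto_iff_tendsto_charFun.1 h (s / √q)).sub_const
      (charFun (γ : Measure ℝ) (s / √q))).norm).const_mul (q : ℝ)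
    rw [sub_self, norm_zero, mul_zero] at this
    exact this.eventually (gt_mem_nhds hε)
  filter_upwards [hbig, hvar, hfin] with j h1 h2 h3
  rw [Real.dist_eq, sub_zero, abs_of_nonneg (by positivity)]
  rcases lt_or_ge (k j) K with hkK | hkK
  · exact h3 _ (Finset.mem_range.2 hkK)
  · have hkp : (0 : ℝ) < k j := by exact_mod_cast hk j
    have a1 := hR (ν j) (hν j) (hν0 j) K (k j) hK1 hkK
    have a2 := hR γ hγ hγ0 K (k j) hK1 hkK
    set A := charFun (ν j : Measure ℝ) (s / √(k j))
    set B := charFun (γ : Measure ℝ) (s / √(k j))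
    set v := ∫ y, y ^ 2 ∂(ν j : Measure ℝ)
    set w := ∫ y, y ^ 2 ∂(γ : Measure ℝ)
    set A' : ℂ := 1 - (v : ℂ) * ((s / √(k j : ℝ) : ℝ) : ℂ) ^ 2 / 2
    set B' : ℂ := 1 - (w : ℂ) * ((s / √(k j : ℝ) : ℝ) : ℂ) ^ 2 / 2
    have a3 : (k j : ℝ) * ‖A' - B'‖ = s ^ 2 / 2 * |v - w| := by
      have : A' - B' = (((w - v) * ((s / √(k j : ℝ)) ^ 2 / 2) : ℝ) : ℂ) := by
        simp only [A', B']; push_cast; ring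
      rw [this, Complex.norm_real, Real.norm_eq_abs, div_pow, Real.sq_sqrt hkp.le, abs_mul,
        abs_sub_comm, abs_of_nonneg (a := s ^ 2 / (k j : ℝ) / 2) (by positivity)]
      field_simp
    have a4 : ‖A - B‖ ≤ ‖A - A'‖ + ‖A' - B'‖ + ‖B - B'‖ := by
      rw [norm_sub_rev B B']
      have e : A - B = (A - A') + (A' - B') + (B' - B) := by ring
      rw [e]
      exact norm_add₃_le
    have a5 := mul_le_mul_of_nonneg_left a4 hkp.le
    rw [mul_add, mul_add] at a5
    linarith

/-- The law of `k^{-1/2} ∑_{j ≤ k} (y_j - c)` for `y_1, …, y_k` iid with law `ρ`. -/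
noncomputable def normalizedSumLaw (ρ : Measure ℝ) (c : ℝ) (k : ℕ) : Measure ℝ :=
  (Measure.pi fun _ : Fin k => ρ).map fun y => (√(k : ℝ))⁻¹ * ∑ j, (y j - c)

lemma measurable_normalizedSum (c : ℝ) (k : ℕ) :
    Measurable fun y : Fin k → ℝ => (√(k : ℝ))⁻¹ * ∑ j, (y j - c) := by
  fun_prop

instance (ρ : Measure ℝ) [IsProbabilityMeasure ρ] (c : ℝ) (k : ℕ) :
    IsProbabilityMeasure (normalizedSumLaw ρ c k) :=
  Measure.isProbabilityMeasure_map (measurable_normalizedSum c k).aemeasurable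

lemma normalizedSumLaw_real_Iic (ρ : Measure ℝ) (c : ℝ) (k : ℕ) (x : ℝ) :
    (normalizedSumLaw ρ c k).real (Set.Iic x)
      = (Measure.pi fun _ : Fin k => ρ).real {y | (√(k : ℝ))⁻¹ * ∑ j, (y j - c) ≤ x} := by
  rw [normalizedSumLaw, map_measureReal_apply (by fun_prop) measurableSet_Iic]
  rfl

lemma charFun_map_sub_const (ρ : Measure ℝ) (c s : ℝ) :
    charFun (ρ.map fun y => y - c) s = ∫ y : ℝ, Complex.exp (s * (y - c : ℝ) * Complex.I) ∂ρ := by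
  rw [charFun_apply_real, integral_map (by fun_prop) (by fun_prop)]

lemma charFun_map_sub_const' (ρ : Measure ℝ) (c s : ℝ) :
    charFun (ρ.map fun y => y - c) s = Complex.exp (-(s * c * Complex.I)) * charFun ρ s := by
  rw [charFun_map_sub_const, charFun_apply_real, ← integral_const_mul]
  congr with y
  rw [← Complex.exp_add]
  push_cast
  ring_nf

lemma charFun_normalizedSumLaw (ρ : Measure ℝ) [IsProbabilityMeasure ρ] (c : ℝ) (k : ℕ) (s : ℝ) :
    charFun (normalizedSumLaw ρ c k) s = charFun (ρ.map fun y => y - c) (s / √(k : ℝ)) ^ k := by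
  rw [normalizedSumLaw, charFun_apply_real, 
    integral_map (measurable_normalizedSum c k).aemeasurable (by fun_prop), charFun_map_sub_const]
  have e : ∀ y : Fin k → ℝ,
      Complex.exp (s * ((√(k : ℝ))⁻¹ * ∑ j, (y j - c) : ℝ) * Complex.I)
        = ∏ j, Complex.exp ((s / √(k : ℝ) : ℝ) * (y j - c : ℝ) * Complex.I) := by
    intro y
    rw [← Complex.exp_sum, ← Finset.sum_mul, ← Finset.mul_sum]
    push_cast
    congr 1
    ring
  simp_rw [e]
  rw [integral_fintype_prod_eq_prod
    (fun (_ : Fin k) (y : ℝ) => Complex.exp ((s / √(k : ℝ) : ℝ) * (y - c : ℝ) * Complex.I))]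
  simp

/-- Stability of the centred Gaussian: the comparison law is the same for every `k`. -/
lemma charFun_gaussianReal_div_sqrt_pow (v : NNReal) {k : ℕ} (hk : 1 ≤ k) (s : ℝ) :
    charFun (gaussianReal 0 v) (s / √(k : ℝ)) ^ k = charFun (gaussianReal 0 v) s := by
  have hkp : (0 : ℝ) < k := by exact_mod_cast hk
  have hk0 : (k : ℂ) ≠ 0 := by exact_mod_cast hkp.ne'
  rw [charFun_gaussianReal, charFun_gaussianReal, ← Complex.exp_nat_mul, ← Complex.ofReal_pow,
    div_pow, Real.sq_sqrt hkp.le]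
  congr 1
  push_cast
  field_simp
  simp

lemma integral_sq_gaussianReal (v : NNReal) : ∫ y, y ^ 2 ∂(gaussianReal 0 v) = v := by
  have h := variance_id_gaussianReal (μ := 0) (v := v)
  rw [variance_eq_integral (by fun_prop)] at h
  simpa using h

lemma integrable_sq_gaussianReal (v : NNReal) :
    Integrable (fun y : ℝ => y ^ 2) (gaussianReal 0 v) :=
  (memLp_id_gaussianReal (μ := 0) (v := v) 2).integrable_sq

variable {v : NNReal}

lemma tendsto_integral_id {ν : ℕ → ProbabilityMeasure ℝ} {γ : ProbabilityMeasure ℝ}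
    (h : Tendsto ν atTop (𝓝 γ))
    (hν : ∀ j, Integrable (fun y => y ^ 2) (ν j : Measure ℝ))
    (hγ : Integrable (fun y => y ^ 2) (γ : Measure ℝ))
    (hlim : Tendsto (fun j => ∫ y, y ^ 2 ∂(ν j : Measure ℝ)) atTop
      (𝓝 (∫ y, y ^ 2 ∂(γ : Measure ℝ)))) :
    Tendsto (fun j => ∫ y, y ∂(ν j : Measure ℝ)) atTop (𝓝 (∫ y, y ∂(γ : Measure ℝ))) := by
  refine tendsto_integral_of_abs_le h (g := fun y => 1 + y ^ 2) (by fun_prop) (by fun_prop)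
    (fun y => ?_) (fun j => (integrable_const _).add (hν j)) ((integrable_const _).add hγ) ?_
  · rw [← sq_abs]
    nlinarith [sq_nonneg (|y| - 1)]
  · simp_rw [integral_add (integrable_const (1 : ℝ)) (hν _)]
    rw [integral_add (integrable_const (1 : ℝ)) hγ]
    simpa using hlim.const_add 1

/-- The central limit theorem for iid sums from a convergent sequence of laws. -/
lemma tendsto_normalizedSumLaw {ν : ℕ → ProbabilityMeasure ℝ}
    (h : Tendsto ν atTop (𝓝 ⟨gaussianReal 0 v, inferInstance⟩))
    (hν : ∀ j, Integrable (fun y => y ^ 2) (ν j : Measure ℝ))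
    (hlim : Tendsto (fun j => ∫ y, y ^ 2 ∂(ν j : Measure ℝ)) atTop (𝓝 v))
    {k : ℕ → ℕ} (hk : ∀ j, 1 ≤ k j) :
    Tendsto (β := ProbabilityMeasure ℝ)
      (fun j => ⟨normalizedSumLaw (ν j) (∫ y, y ∂(ν j : Measure ℝ)) (k j), inferInstance⟩) atTop
      (𝓝 ⟨gaussianReal 0 v, inferInstance⟩) := by
  set γ : ProbabilityMeasure ℝ := ⟨gaussianReal 0 v, inferInstance⟩ with hγdef
  have hγ2 : Integrable (fun y => y ^ 2) (γ : Measure ℝ) := integrable_sq_gaussianReal v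
  have hγv : ∫ y, y ^ 2 ∂(γ : Measure ℝ) = v := integral_sq_gaussianReal v
  have hγ0 : ∫ y, y ∂(γ : Measure ℝ) = 0 := integral_id_gaussianReal
  set m : ℕ → ℝ := fun j => ∫ y, y ∂(ν j : Measure ℝ) with hm
  have hm0 : Tendsto m atTop (𝓝 0) := by
    rw [← hγ0]
    exact tendsto_integral_id h hν hγ2 (by rwa [hγv])
  let ν' : ℕ → ProbabilityMeasure ℝ := fun j =>
    ⟨(ν j : Measure ℝ).map fun y => y - m j, Measure.isProbabilityMeasure_map (by fun_prop)⟩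
  have hν'coe : ∀ j, (ν' j : Measure ℝ) = (ν j : Measure ℝ).map fun y => y - m j := fun _ => rfl
  have hν1 : ∀ j, Integrable (fun y => y) (ν j : Measure ℝ) := fun j => integrable_id_of_sq (hν j)
  have hexp : ∀ j, (fun y : ℝ => (y - m j) ^ 2) = fun y => y ^ 2 - 2 * m j * y + m j ^ 2 :=
    fun j => by ext; ring
  have hsub : ∀ j, Integrable (fun y : ℝ => y ^ 2 - 2 * m j * y) (ν j : Measure ℝ) :=
    fun j => (hν j).sub ((hν1 j).const_mul _)
  have hν'2 : ∀ j, Integrable (fun y => y ^ 2) (ν' j : Measure ℝ) := by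
    intro j
    rw [hν'coe, integrable_map_measure (by fun_prop) (by fun_prop)]
    change Integrable (fun y : ℝ => (y - m j) ^ 2) _
    rw [hexp]
    exact (hsub j).add (integrable_const _)
  have hν'0 : ∀ j, ∫ y, y ∂(ν' j : Measure ℝ) = 0 := by
    intro j
    rw [hν'coe, integral_map (by fun_prop) (by fun_prop),
      integral_sub (hν1 j) (integrable_const _)]
    simp [hm]
  have hν'v : ∀ j, ∫ y, y ^ 2 ∂(ν' j : Measure ℝ) = ∫ y, y ^ 2 ∂(ν j : Measure ℝ) - m j ^ 2 := by
    intro j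
    rw [hν'coe, integral_map (by fun_prop) (by fun_prop), hexp,
      integral_add (hsub j) (integrable_const _), integral_sub (hν j) ((hν1 j).const_mul _),
      integral_const_mul]
    simp [hm]
    ring
  have hlim' : Tendsto (fun j => ∫ y, y ^ 2 ∂(ν' j : Measure ℝ)) atTop
      (𝓝 (∫ y, y ^ 2 ∂(γ : Measure ℝ))) := by
    simp_rw [hν'v, hγv]
    simpa using hlim.sub (hm0.pow 2)
  -- Centring multiplies the characteristic function by a phase that tends to 1, since the means
  -- tend to 0.
  have hν' : Tendsto ν' atTop (𝓝 γ) := by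
    refine ProbabilityMeasure.tendsto_of_tendsto_charFun fun s => ?_
    simp_rw [hν'coe, charFun_map_sub_const']
    have h1 : Tendsto (fun j => Complex.exp (-(s * (m j : ℂ) * Complex.I))) atTop (𝓝 1) := by
      have h2 : Continuous fun r : ℝ => Complex.exp (-(s * (r : ℂ) * Complex.I)) := by fun_prop
      have := (h2.tendsto 0).comp hm0
      simpa [Function.comp_def] using this
    simpa using h1.mul (ProbabilityMeasure.tendsto_iff_tendsto_charFun.1 h s)
  refine ProbabilityMeasure.tendsto_of_tendsto_charFun fun s => ?_
  rw [tendsto_iff_norm_sub_tendsto_zero]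
  refine squeeze_zero (fun _ => norm_nonneg _) (fun j => ?_)
    (tendsto_mul_norm_charFun_sub hν' hν'2 hγ2 hν'0 hγ0 hlim' hk s)
  change ‖charFun (normalizedSumLaw (ν j) (m j) (k j)) s - charFun (gaussianReal 0 v) s‖ ≤ _
  rw [charFun_normalizedSumLaw, ← charFun_gaussianReal_div_sqrt_pow v (hk j) s]
  exact norm_pow_sub_pow_le_of_norm_le_one (norm_charFun_le_one (μ := (ν' j : Measure ℝ)) _)
    (norm_charFun_le_one _) _

lemma gaussianReal_singleton (hv : v ≠ 0) (x : ℝ) : gaussianReal 0 v {x} = 0 := by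
  have := nullSingletonClass_gaussianReal (μ := 0) hv
  simp

/-- Closeness in distribution function and second moment to a centred Gaussian law forces the
law of the normalized centred iid sums to be close to this Gaussian law, uniformly in the number
of summands. -/
lemma exists_forall_normalizedSumLaw_close (hv : v ≠ 0) {ε : ℝ} (hε : 0 < ε) :
    ∃ δ > 0, ∀ ρ : ProbabilityMeasure ℝ, Integrable (fun y => y ^ 2) (ρ : Measure ℝ) →
      (∀ x, |(ρ : Measure ℝ).real (Set.Iic x) - (gaussianReal 0 v).real (Set.Iic x)| ≤ δ) →
      |∫ y, y ^ 2 ∂(ρ : Measure ℝ) - v| ≤ δ →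
      |∫ y, y ∂(ρ : Measure ℝ)| ≤ ε ∧ ∀ k : ℕ, 1 ≤ k → ∀ x,
        |(normalizedSumLaw ρ (∫ y, y ∂(ρ : Measure ℝ)) k).real (Set.Iic x)
          - (gaussianReal 0 v).real (Set.Iic x)| ≤ ε := by
  -- If no `δ` works, counterexamples for `δ = 1 / (j + 1)` form a sequence converging to the
  -- Gaussian law, to which the limit theorem applies.
  by_contra! hcon
  have hpos : ∀ j : ℕ, (0 : ℝ) < 1 / ((j : ℝ) + 1) := fun j => Nat.one_div_pos_of_nat
  choose ρ hρ2 hρc hρv hbad using fun j : ℕ => hcon _ (hpos j)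
  have hlim0 : Tendsto (fun j : ℕ => 1 / ((j : ℝ) + 1)) atTop (𝓝 0) :=
    tendsto_one_div_add_atTop_nhds_zero_nat
  set γ : ProbabilityMeasure ℝ := ⟨gaussianReal 0 v, inferInstance⟩ with hγdef
  have hγ2 : Integrable (fun y => y ^ 2) (γ : Measure ℝ) := integrable_sq_gaussianReal v
  have hγv : ∫ y, y ^ 2 ∂(γ : Measure ℝ) = v := integral_sq_gaussianReal v
  have hγ0 : ∫ y, y ∂(γ : Measure ℝ) = 0 := integral_id_gaussianReal
  have hρ : Tendsto ρ atTop (𝓝 γ) := by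
    refine tendsto_of_tendsto_measureReal_Iic fun x => ?_
    rw [tendsto_iff_norm_sub_tendsto_zero]
    exact squeeze_zero (fun _ => norm_nonneg _) (fun j => hρc j x) hlim0
  have hsec : Tendsto (fun j => ∫ y, y ^ 2 ∂(ρ j : Measure ℝ)) atTop (𝓝 v) := by
    rw [tendsto_iff_norm_sub_tendsto_zero]
    exact squeeze_zero (fun _ => norm_nonneg _) hρv hlim0
  have hmean : ∀ᶠ j in atTop, |∫ y, y ∂(ρ j : Measure ℝ)| ≤ ε := by
    have := (tendsto_integral_id hρ hρ2 hγ2 (by rwa [hγv])).abs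
    rw [hγ0, abs_zero] at this
    exact (this.eventually (gt_mem_nhds hε)).mono fun _ h => h.le
  have hex : ∀ j, ∃ k : ℕ, 1 ≤ k ∧ (|∫ y, y ∂(ρ j : Measure ℝ)| ≤ ε → ∃ x,
      ε < |(normalizedSumLaw (ρ j) (∫ y, y ∂(ρ j : Measure ℝ)) k).real (Set.Iic x)
          - (gaussianReal 0 v).real (Set.Iic x)|) := by
    intro j
    by_cases hj : |∫ y, y ∂(ρ j : Measure ℝ)| ≤ ε
    · obtain ⟨k, hk, x, hx⟩ := hbad j hj
      exact ⟨k, hk, fun _ => ⟨x, hx⟩⟩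
    · exact ⟨1, le_rfl, fun h => absurd h hj⟩
  choose k hk hkx using hex
  have hT := tendsto_normalizedSumLaw hρ hρ2 hsec hk
  obtain ⟨A, hA⟩ := exists_finset_forall_abs_measureReal_Iic_sub_le (gaussianReal 0 v)
    (gaussianReal_singleton hv) hε
  have hev : ∀ᶠ j in atTop, ∀ a ∈ A,
      |(normalizedSumLaw (ρ j) (∫ y, y ∂(ρ j : Measure ℝ)) (k j)).real (Set.Iic a)
        - (gaussianReal 0 v).real (Set.Iic a)| ≤ ε / 2 := by
    rw [eventually_all_finset]
    intro a _
    have := tendsto_measureReal_Iic_of_tendsto hT a (gaussianReal_singleton hv a)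
    rw [tendsto_iff_norm_sub_tendsto_zero] at this
    exact (this.eventually (gt_mem_nhds (half_pos hε))).mono fun _ h => h.le
  obtain ⟨j, h1, h2⟩ := (hmean.and hev).exists
  obtain ⟨x, hx⟩ := hkx j h1
  refine absurd (hA _ ?_ ?_ ?_ h2 x) (not_le.2 hx)
  · exact fun a b hab => measureReal_mono (Set.Iic_subset_Iic.2 hab)
  · exact fun _ => measureReal_nonneg
  · exact fun _ => measureReal_le_one

lemma exists_forall_abs_integral_sub_le (γ : ProbabilityMeasure ℝ) {f : ℝ → ℝ} (hf : Continuous f)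
    {C : ℝ} (hC : ∀ y, |f y| ≤ C) {ε : ℝ} (hε : 0 < ε) :
    ∃ δ > 0, ∀ ρ : ProbabilityMeasure ℝ,
      (∀ x, |(ρ : Measure ℝ).real (Set.Iic x) - (γ : Measure ℝ).real (Set.Iic x)| ≤ δ) →
      |∫ y, f y ∂(ρ : Measure ℝ) - ∫ y, f y ∂(γ : Measure ℝ)| ≤ ε := by
  by_contra! hcon
  have hpos : ∀ j : ℕ, (0 : ℝ) < 1 / ((j : ℝ) + 1) := fun j => Nat.one_div_pos_of_nat
  choose ρ hρc hbad using fun j : ℕ => hcon _ (hpos j)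
  have hρ : Tendsto ρ atTop (𝓝 γ) := by
    refine tendsto_of_tendsto_measureReal_Iic fun x => ?_
    rw [tendsto_iff_norm_sub_tendsto_zero]
    exact squeeze_zero (fun _ => norm_nonneg _) (fun j => hρc j x)
      tendsto_one_div_add_atTop_nhds_zero_nat
  have := tendsto_integral_of_abs_le hρ hf continuous_const hC (fun _ => integrable_const C)
    (integrable_const C) (by simp)
  rw [tendsto_iff_norm_sub_tendsto_zero] at this
  obtain ⟨j, hj⟩ := (this.eventually (gt_mem_nhds hε)).exists
  exact absurd hj (not_lt.2 (hbad j).le)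

lemma sq_sub_min_le_ite (M y : ℝ) :
    0 ≤ y ^ 2 - min (y ^ 2) (M ^ 2) ∧
      y ^ 2 - min (y ^ 2) (M ^ 2) ≤ if M < |y| then y ^ 2 else 0 := by
  refine ⟨sub_nonneg.2 (min_le_left _ _), ?_⟩
  split_ifs with h
  · have : 0 ≤ min (y ^ 2) (M ^ 2) := by positivity
    linarith
  · rw [min_eq_left (by rw [← sq_abs y]; gcongr; exact not_lt.1 h), sub_self]

/-- Three errors of `ε / 3`: truncating the Gaussian second moment, comparing the integrals of the
bounded continuous `min (y ^ 2) (m ^ 2)`, and the tail of `ρ`. All large `m` are allowed, and `m`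
precedes `δ`, so that `m` can later be dictated by the tail condition. -/
lemma exists_forall_abs_second_moment_sub_le {ε : ℝ} (hε : 0 < ε) :
    ∃ m₀ : ℕ, ∀ m ≥ m₀, ∃ δ > 0, ∀ ρ : ProbabilityMeasure ℝ,
      Integrable (fun y => y ^ 2) (ρ : Measure ℝ) →
      (∀ x, |(ρ : Measure ℝ).real (Set.Iic x) - (gaussianReal 0 v).real (Set.Iic x)| ≤ δ) →
      ∫ y, (if (m : ℝ) < |y| then y ^ 2 else 0) ∂(ρ : Measure ℝ) ≤ ε / 3 →
      |∫ y, y ^ 2 ∂(ρ : Measure ℝ) - v| ≤ ε := by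
  set γ : ProbabilityMeasure ℝ := ⟨gaussianReal 0 v, inferInstance⟩ with hγdef
  have hγ2 : Integrable (fun y => y ^ 2) (γ : Measure ℝ) := integrable_sq_gaussianReal v
  have hγv : ∫ y, y ^ 2 ∂(γ : Measure ℝ) = v := integral_sq_gaussianReal v
  have hT : Tendsto (fun m : ℕ => ∫ y, min (y ^ 2) ((m : ℝ) ^ 2) ∂(γ : Measure ℝ)) atTop
      (𝓝 (∫ y, y ^ 2 ∂(γ : Measure ℝ))) := by
    refine tendsto_integral_of_dominated_convergence (fun y => y ^ 2) (fun K => by fun_prop) hγ2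
      (fun K => ae_of_all _ fun y => ?_) (ae_of_all _ fun y => ?_)
    · rw [Real.norm_of_nonneg (by positivity)]
      exact min_le_left _ _
    · obtain ⟨M, hM⟩ := exists_nat_ge |y|
      refine tendsto_const_nhds.congr' ?_
      filter_upwards [eventually_ge_atTop M] with m hm
      rw [min_eq_left]
      rw [← sq_abs y]
      have : (M : ℝ) ≤ m := by exact_mod_cast hm
      gcongr
      linarith
  rw [tendsto_iff_norm_sub_tendsto_zero] at hT
  obtain ⟨m₀, hm₀⟩ := eventually_atTop.1
    (hT.eventually (gt_mem_nhds (show 0 < ε / 3 by linarith)))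
  refine ⟨m₀, fun m hm => ?_⟩
  obtain ⟨δ, hδ, H⟩ := exists_forall_abs_integral_sub_le γ
    (f := fun y => min (y ^ 2) ((m : ℝ) ^ 2)) (by fun_prop) (C := (m : ℝ) ^ 2)
    (fun y => by rw [abs_of_nonneg (by positivity)]; exact min_le_right _ _)
    (show 0 < ε / 3 by linarith)
  refine ⟨δ, hδ, fun ρ hρ2 hρc hρt => ?_⟩
  have h1 := abs_le.1 (H ρ hρc)
  have h2 := abs_lt.1 (hm₀ m hm)
  have hmin : Integrable (fun y : ℝ => min (y ^ 2) ((m : ℝ) ^ 2)) (ρ : Measure ℝ) := by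
    refine hρ2.mono' (by fun_prop) (ae_of_all _ fun y => ?_)
    rw [Real.norm_of_nonneg (by positivity)]
    exact min_le_left _ _
  have hite : Integrable (fun y : ℝ => if (m : ℝ) < |y| then y ^ 2 else 0) (ρ : Measure ℝ) := by
    refine hρ2.mono' (Measurable.aestronglyMeasurable ?_) (ae_of_all _ fun y => ?_)
    · exact Measurable.ite (measurableSet_lt measurable_const (by fun_prop)) (by fun_prop)
        measurable_const
    · split_ifs
      · rw [Real.norm_of_nonneg (by positivity)]
      · simpa using sq_nonneg y
  have h3 : ∫ y, y ^ 2 ∂(ρ : Measure ℝ) - ∫ y, min (y ^ 2) ((m : ℝ) ^ 2) ∂(ρ : Measure ℝ)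
      ≤ ε / 3 := by
    rw [← integral_sub hρ2 hmin]
    refine (integral_mono (hρ2.sub hmin) hite fun y => ?_).trans hρt
    exact (sq_sub_min_le_ite (m : ℝ) y).2
  have h4 : 0 ≤ ∫ y, y ^ 2 ∂(ρ : Measure ℝ)
      - ∫ y, min (y ^ 2) ((m : ℝ) ^ 2) ∂(ρ : Measure ℝ) := by
    rw [← integral_sub hρ2 hmin]
    exact integral_nonneg fun y => (sq_sub_min_le_ite (m : ℝ) y).1
  rw [hγv] at h2
  rw [abs_le]
  constructor <;> linarith

/-! ### Blocks and the σ-algebras of past and future. -/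

section Generated

variable {Ω : Type*} {X : ℤ → Ω → ℝ}

lemma futureSigma_anti {i j : ℤ} (h : i ≤ j) : futureSigma X j ≤ futureSigma X i :=
  iSup_le fun t => le_iSup (fun t : {t : ℤ // i ≤ t} => MeasurableSpace.comap (X t) inferInstance)
    ⟨t.1, h.trans t.2⟩

lemma measurable_pastSigma {t i : ℤ} (h : t ≤ i) : Measurable[pastSigma X i] (X t) :=
  Measurable.of_comap_le
    (le_iSup (fun t : {t : ℤ // t ≤ i} => MeasurableSpace.comap (X t) inferInstance) ⟨t, h⟩)

lemma measurable_futureSigma {t i : ℤ} (h : i ≤ t) : Measurable[futureSigma X i] (X t) :=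
  Measurable.of_comap_le
    (le_iSup (fun t : {t : ℤ // i ≤ t} => MeasurableSpace.comap (X t) inferInstance) ⟨t, h⟩)

/-- The last entry has time `i + m - 1`; the σ-algebra is one step larger than necessary, which
avoids subtraction. -/
lemma measurable_block_pastSigma (m i : ℕ) :
    Measurable[pastSigma X ((i : ℤ) + m)] (block X m i) :=
  @measurable_pi_lambda _ _ _ (pastSigma X ((i : ℤ) + m)) _ _ fun j =>
    measurable_pastSigma (by have := j.2; omega)

lemma measurable_block_futureSigma (m i : ℕ) :
    Measurable[futureSigma X i] (block X m i) :=
  @measurable_pi_lambda _ _ _ (futureSigma X i) _ _ fun j => measurable_futureSigma (by omega)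

end Generated

variable {Ω : Type*} [MeasurableSpace Ω]

/-! ### Events of high probability. -/

section HighProbability

/-- The events `E n` hold with probability tending to one. -/
def WithHighProb (μ : Measure Ω) (E : ℕ → Ω → Prop) : Prop :=
  Tendsto (fun n => μ {ω | ¬ E n ω}) atTop (𝓝 0)

variable {μ : Measure Ω} {E F : ℕ → Ω → Prop}

/-- This calculus uses only monotonicity and subadditivity of the outer measure, so events
quantified over all real `x` need no measurability. -/
lemma WithHighProb.mono (hE : WithHighProb μ E) (h : ∀ᶠ n in atTop, ∀ ω, E n ω → F n ω) :
    WithHighProb μ F := by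
  refine tendsto_of_tendsto_of_tendsto_of_le_of_le' tendsto_const_nhds hE
    (Eventually.of_forall fun _ => zero_le) ?_
  filter_upwards [h] with n hn
  exact measure_mono fun ω hω hE => hω (hn ω hE)

lemma WithHighProb.and (hE : WithHighProb μ E) (hF : WithHighProb μ F) :
    WithHighProb μ fun n ω => E n ω ∧ F n ω := by
  refine tendsto_of_tendsto_of_tendsto_of_le_of_le tendsto_const_nhds
    (by simpa using Tendsto.add hE hF) (fun _ => zero_le) fun n => ?_
  refine (measure_mono ?_).trans (measure_union_le _ _)
  intro ω hω
  by_contra hcon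
  simp only [Set.mem_union, Set.mem_ofPred_eq, not_or, not_not] at hcon
  exact hω hcon

lemma withHighProb_forall_finset {ι : Type*} (A : Finset ι) {E : ι → ℕ → Ω → Prop}
    (h : ∀ a ∈ A, WithHighProb μ (E a)) : WithHighProb μ fun n ω => ∀ a ∈ A, E a n ω := by
  classical
  induction A using Finset.induction_on with
  | empty => simp [WithHighProb]
  | insert a s _ ih =>
    refine ((h a (Finset.mem_insert_self _ _)).and
      (ih fun i hi => h i (Finset.mem_insert_of_mem hi))).mono (Eventually.of_forall ?_)
    rintro n ω ⟨h1, h2⟩ i hi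
    rcases Finset.mem_insert.1 hi with rfl | hi
    · exact h1
    · exact h2 i hi

lemma tendstoInMeasure_iff_withHighProb {f : ℕ → Ω → ℝ} {g : Ω → ℝ} :
    TendstoInMeasure μ f atTop g ↔
      ∀ ε > 0, WithHighProb μ fun n ω => |f n ω - g ω| < ε := by
  rw [tendstoInMeasure_iff_dist]
  simp only [WithHighProb, not_lt, Real.dist_eq]

lemma tendstoInMeasure_iSup {F : ℕ → Ω → ℝ → ℝ}
    (h : ∀ ε > 0, WithHighProb μ fun n ω => ∀ x, |F n ω x| ≤ ε) :
    TendstoInMeasure μ (fun n ω => ⨆ x, |F n ω x|) atTop (fun _ => 0) := by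
  rw [tendstoInMeasure_iff_withHighProb]
  intro ε hε
  refine (h (ε / 2) (half_pos hε)).mono (Eventually.of_forall fun n ω hω => ?_)
  rw [sub_zero, abs_of_nonneg (Real.iSup_nonneg fun _ => abs_nonneg _)]
  exact (ciSup_le hω).trans_lt (half_lt_self hε)

/-- Events that have probability eventually as close to one as desired hold with high
probability. -/
lemma withHighProb_of_forall_pos (h : ∀ ε : ℝ≥0∞, 0 < ε → ∀ᶠ n in atTop, μ {ω | ¬ E n ω} ≤ ε) :
    WithHighProb μ E :=
  ENNReal.tendsto_nhds_zero.2 h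

end HighProbability

/-! ### Covariance bounds under mixing. -/

section Mixing

variable {μ : Measure Ω} [IsProbabilityMeasure μ] {X : ℤ → Ω → ℝ}

lemma abs_measureReal_inter_sub_mul_le_one (A B : Set Ω) :
    |μ.real (A ∩ B) - μ.real A * μ.real B| ≤ 1 := by
  have h1 : μ.real (A ∩ B) ≤ 1 := measureReal_le_one
  have h2 : 0 ≤ μ.real (A ∩ B) := measureReal_nonneg
  have h3 : μ.real A * μ.real B ≤ 1 := mul_le_one₀ measureReal_le_one measureReal_nonneg
    measureReal_le_one
  have h4 : 0 ≤ μ.real A * μ.real B := mul_nonneg measureReal_nonneg measureReal_nonneg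
  rw [abs_le]
  constructor <;> linarith

lemma abs_measureReal_inter_sub_mul_le_alphaMixing {i : ℤ} {k : ℕ} {A B : Set Ω}
    (hA : MeasurableSet[pastSigma X i] A) (hB : MeasurableSet[futureSigma X (i + k)] B) :
    |μ.real (A ∩ B) - μ.real A * μ.real B| ≤ alphaMixing μ X k := by
  refine le_csSup ⟨1, ?_⟩ ⟨i, A, B, hA, hB, rfl⟩
  rintro _ ⟨_, A, B, -, -, rfl⟩
  exact abs_measureReal_inter_sub_mul_le_one A B

/-- The second moment of a centred average of indicators of weakly dependent events. -/
lemma integral_sq_average_indicator_sub_le {A : ℕ → Set Ω} (hA : ∀ i, MeasurableSet (A i))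
    {N L : ℕ} (hN : 1 ≤ N) {η : ℝ} (hη : 0 ≤ η)
    (hcov : ∀ i j, i + L ≤ j → |μ.real (A i ∩ A j) - μ.real (A i) * μ.real (A j)| ≤ η) :
    ∫ ω, ((N : ℝ)⁻¹ * ∑ i ∈ Finset.Icc 1 N, ((A i).indicator 1 ω - μ.real (A i))) ^ 2 ∂μ
      ≤ 2 * L / N + η := by
  have hNp : (0 : ℝ) < N := by exact_mod_cast hN
  set c : ℕ → ℕ → ℝ := fun i j => μ.real (A i ∩ A j) - μ.real (A i) * μ.real (A j) with hc
  have hcomm : ∀ i j, c i j = c j i := fun i j => by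
    simp only [hc]; rw [Set.inter_comm, mul_comm]
  have hind : ∀ B : Set Ω, MeasurableSet B → Integrable (B.indicator (1 : Ω → ℝ)) μ := fun B hB =>
    (integrable_const (1 : ℝ)).indicator hB
  have hprod : ∀ i j, ∀ ω, ((A i).indicator (1 : Ω → ℝ) ω - μ.real (A i)) *
      ((A j).indicator (1 : Ω → ℝ) ω - μ.real (A j))
      = (A i ∩ A j).indicator (1 : Ω → ℝ) ω - μ.real (A j) * (A i).indicator (1 : Ω → ℝ) ω
        - μ.real (A i) * (A j).indicator (1 : Ω → ℝ) ω + μ.real (A i) * μ.real (A j) := by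
    intro i j ω
    rw [Set.inter_indicator_one]
    simp only [Pi.mul_apply]
    ring
  have hI1 : ∀ i j, Integrable (fun ω => (A i ∩ A j).indicator (1 : Ω → ℝ) ω
      - μ.real (A j) * (A i).indicator (1 : Ω → ℝ) ω) μ := fun i j =>
    (hind _ ((hA i).inter (hA j))).sub ((hind _ (hA i)).const_mul _)
  have hI2 : ∀ i j, Integrable (fun ω => (A i ∩ A j).indicator (1 : Ω → ℝ) ω
      - μ.real (A j) * (A i).indicator (1 : Ω → ℝ) ω
      - μ.real (A i) * (A j).indicator (1 : Ω → ℝ) ω) μ := fun i j =>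
    (hI1 i j).sub ((hind _ (hA j)).const_mul _)
  have hI : ∀ i j, Integrable (fun ω => ((A i).indicator (1 : Ω → ℝ) ω - μ.real (A i)) *
      ((A j).indicator (1 : Ω → ℝ) ω - μ.real (A j))) μ := by
    intro i j
    simp_rw [hprod]
    exact (hI2 i j).add (integrable_const _)
  have hint : ∀ i j, ∫ ω, ((A i).indicator (1 : Ω → ℝ) ω - μ.real (A i)) *
      ((A j).indicator (1 : Ω → ℝ) ω - μ.real (A j)) ∂μ = c i j := by
    intro i j
    simp_rw [hprod]
    rw [integral_add (hI2 i j) (integrable_const _),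
      integral_sub (hI1 i j) ((hind _ (hA j)).const_mul _),
      integral_sub (hind _ ((hA i).inter (hA j))) ((hind _ (hA i)).const_mul _),
      integral_const_mul, integral_const_mul, integral_indicator_one ((hA i).inter (hA j)),
      integral_indicator_one (hA i), integral_indicator_one (hA j)]
    simp [hc]
    ring
  -- Pairs at distance less than `L` get the trivial bound 1, and each row has at most `2 * L` of
  -- them; truncated subtraction only shortens the interval.
  have hbound : ∀ i j, c i j ≤ (if j ∈ Finset.Ico (i + 1 - L) (i + L) then 1 else 0) + η := by
    intro i j
    split_ifs with hij
    · have := (abs_le.1 (abs_measureReal_inter_sub_mul_le_one (μ := μ) (A i) (A j))).2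
      simp only [hc]
      linarith
    · rw [zero_add]
      rw [Finset.mem_Ico] at hij
      rcases Nat.lt_or_ge j (i + L) with h | h
      · rw [hcomm]
        exact (abs_le.1 (hcov j i (by omega))).2
      · exact (abs_le.1 (hcov i j h)).2
  have hrow : ∀ i, ∑ j ∈ Finset.Icc 1 N, c i j ≤ 2 * L + N * η := by
    intro i
    refine (Finset.sum_le_sum fun j _ => hbound i j).trans ?_
    rw [Finset.sum_add_distrib, ← Finset.sum_filter, Finset.sum_const, Finset.sum_const]
    simp only [nsmul_eq_mul, mul_one, Nat.card_Icc, Nat.add_sub_cancel]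
    gcongr
    have h1 : ((Finset.Icc 1 N).filter fun j => j ∈ Finset.Ico (i + 1 - L) (i + L)).card
        ≤ (Finset.Ico (i + 1 - L) (i + L)).card :=
      Finset.card_le_card fun j hj => (Finset.mem_filter.1 hj).2
    rw [Nat.card_Ico] at h1
    have h2 : ((Finset.Icc 1 N).filter fun j => j ∈ Finset.Ico (i + 1 - L) (i + L)).card
        ≤ 2 * L := by omega
    exact_mod_cast h2
  have hexpand : ∀ ω, ((N : ℝ)⁻¹ * ∑ i ∈ Finset.Icc 1 N,
      ((A i).indicator (1 : Ω → ℝ) ω - μ.real (A i))) ^ 2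
      = ((N : ℝ)⁻¹) ^ 2 * ∑ i ∈ Finset.Icc 1 N, ∑ j ∈ Finset.Icc 1 N,
        ((A i).indicator (1 : Ω → ℝ) ω - μ.real (A i)) *
          ((A j).indicator (1 : Ω → ℝ) ω - μ.real (A j)) := by
    intro ω
    rw [mul_pow, sq (∑ i ∈ Finset.Icc 1 N, _), Finset.sum_mul_sum]
  simp_rw [hexpand]
  rw [integral_const_mul, integral_finsetSum _ fun i _ => integrable_finsetSum _ fun j _ => hI i j]
  simp_rw [integral_finsetSum _ fun j _ => hI _ j, hint]
  calc _ ≤ ((N : ℝ)⁻¹) ^ 2 * ∑ i ∈ Finset.Icc 1 N, (2 * L + N * η : ℝ) := by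
        gcongr with i _
        exact hrow i
    _ = 2 * L / N + η := by
        rw [Finset.sum_const]
        simp only [nsmul_eq_mul, Nat.card_Icc, Nat.add_sub_cancel]
        field_simp

end Mixing

/-! ### The empirical law of the subsample statistics. -/

section SubLaw

variable {Ω : Type*} (X : ℤ → Ω → ℝ) (t : ∀ m : ℕ, (Fin m → ℝ) → ℝ) (τ : ℕ → ℝ) (n b : ℕ) (ω : Ω)

lemma numBlocks_pos : 0 < numBlocks n b := Nat.succ_pos _

instance : IsProbabilityMeasure (subLaw X t τ n b ω) := by
  constructor
  have h : (numBlocks n b : ℝ≥0∞) ≠ 0 := by exact_mod_cast (numBlocks_pos n b).ne'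
  simp [subLaw, ENNReal.inv_mul_cancel h]

lemma integrable_subLaw (f : ℝ → ℝ) : Integrable f (subLaw X t τ n b ω) := by
  have h : (numBlocks n b : ℝ≥0∞) ≠ 0 := by exact_mod_cast (numBlocks_pos n b).ne'
  refine Integrable.smul_measure ?_ (ENNReal.inv_ne_top.2 h)
  exact integrable_finsetSum_measure.2 fun i _ => integrable_dirac (by simp)

lemma integral_subLaw (f : ℝ → ℝ) :
    ∫ y, f y ∂(subLaw X t τ n b ω)
      = (numBlocks n b : ℝ)⁻¹ * ∑ i ∈ Finset.Icc 1 (numBlocks n b), f (subStat X t τ n b i ω) := by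
  rw [subLaw, integral_smul_measure,
    integral_finsetSum_measure fun i _ => integrable_dirac (by simp)]
  simp

lemma subLaw_real_Iic (x : ℝ) :
    (subLaw X t τ n b ω).real (Set.Iic x) = subDist X t τ n b x ω := by
  classical
  rw [← integral_indicator_one measurableSet_Iic, integral_subLaw, subDist]
  congr 1

lemma integral_id_subLaw : ∫ y, y ∂(subLaw X t τ n b ω) = subMean X t τ n b ω :=
  integral_subLaw X t τ n b ω fun y => y

lemma integral_sq_subLaw_sub :
    ∫ y, y ^ 2 ∂(subLaw X t τ n b ω) - subMean X t τ n b ω ^ 2 = subVar X t τ n b ω := by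
  set m := subMean X t τ n b ω with hm
  have h : subVar X t τ n b ω = ∫ y, (y - m) ^ 2 ∂(subLaw X t τ n b ω) :=
    (integral_subLaw X t τ n b ω fun y => (y - m) ^ 2).symm
  have e : (fun y : ℝ => (y - m) ^ 2) = fun y => y ^ 2 - (2 * m * y - m ^ 2) := by ext; ring
  rw [h, e, integral_sub (integrable_subLaw ..) (integrable_subLaw ..),
    integral_sub (integrable_subLaw ..) (integrable_subLaw ..), integral_const_mul,
    integral_id_subLaw, ← hm]
  simp
  ring

lemma normalizedSumLaw_subLaw_real_Iic (k : ℕ) (x : ℝ) :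
    (normalizedSumLaw (subLaw X t τ n b ω) (subMean X t τ n b ω) k).real (Set.Iic x)
      = convDist X t τ n b k x ω :=
  normalizedSumLaw_real_Iic _ _ _ _

/-- The estimation error `τ_b (t_n - θ)` on the scale of the blocks. -/
noncomputable def rescaledError (θ : ℝ) : ℝ := τ b * (t n (block X n 1 ω) - θ)

lemma subStat_eq (θ : ℝ) (i : ℕ) :
    subStat X t τ n b i ω = blockRoot X t τ θ b i ω - rescaledError X t τ n b ω θ := by
  simp only [subStat, blockRoot, rescaledError]
  ring

open Classical in
/-- The empirical distribution function of the block roots `T_{b,i}`. -/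
noncomputable def rootEmpDist (θ : ℝ) (x : ℝ) : ℝ :=
  (numBlocks n b : ℝ)⁻¹ *
    ∑ i ∈ Finset.Icc 1 (numBlocks n b), if blockRoot X t τ θ b i ω ≤ x then (1 : ℝ) else 0

variable {X t τ n b ω}

lemma subDist_le_rootEmpDist {θ δ : ℝ} (hδ : rescaledError X t τ n b ω θ ≤ δ) (x : ℝ) :
    subDist X t τ n b x ω ≤ rootEmpDist X t τ n b ω θ (x + δ) := by
  unfold subDist rootEmpDist
  gcongr with i _
  rw [subStat_eq X t τ n b ω θ]
  split_ifs <;> linarith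

lemma rootEmpDist_le_subDist {θ δ : ℝ} (hδ : -δ ≤ rescaledError X t τ n b ω θ) (x : ℝ) :
    rootEmpDist X t τ n b ω θ (x - δ) ≤ subDist X t τ n b x ω := by
  unfold subDist rootEmpDist
  gcongr with i _
  rw [subStat_eq X t τ n b ω θ]
  split_ifs <;> linarith

/-- If `|U| ≤ 1` and `|T - U| > m + 1`, then `|T| > m ≥ 1`, hence `|T - U| ≤ 2 |T|`; squaring gives
the factor 4. -/
lemma integral_truncated_subLaw_le {θ : ℝ} (hU : |rescaledError X t τ n b ω θ| ≤ 1) {m : ℕ}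
    (hm : 1 ≤ m) :
    ∫ y, (if ((m + 1 : ℕ) : ℝ) < |y| then y ^ 2 else 0) ∂(subLaw X t τ n b ω)
      ≤ 4 * truncSecondMoment X t τ θ n b m ω := by
  rw [integral_subLaw, truncSecondMoment, mul_left_comm]
  refine mul_le_mul_of_nonneg_left ?_ (inv_nonneg.2 (Nat.cast_nonneg _))
  rw [Finset.mul_sum]
  refine Finset.sum_le_sum fun i _ => ?_
  rw [subStat_eq X t τ n b ω θ]
  set T := blockRoot X t τ θ b i ω
  set U := rescaledError X t τ n b ω θ
  have hm' : (1 : ℝ) ≤ m := by exact_mod_cast hm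
  have habs : |T - U| ≤ |T| + |U| := abs_sub T U
  push_cast
  by_cases h1 : (m : ℝ) + 1 < |T - U|
  · have h2 : (m : ℝ) < |T| := by linarith
    rw [if_pos h1, if_pos h2, ← sq_abs, ← sq_abs T]
    nlinarith [abs_nonneg (T - U)]
  · rw [if_neg h1]
    split_ifs <;> positivity

end SubLaw

/-! ### Convergence in probability of the subsampling estimators. -/

lemma stdNormalCDF_div {σ : ℝ} (hσ : 0 < σ) (x : ℝ) :
    stdNormalCDF (x / σ) = (gaussianReal 0 (σ ^ 2).toNNReal).real (Set.Iic x) := by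
  have h : gaussianReal 0 (σ ^ 2).toNNReal = (gaussianReal 0 1).map (σ * ·) := by
    rw [gaussianReal_map_const_mul, mul_zero, mul_one]
    congr 1
    ext
    simp [sq_nonneg]
  rw [stdNormalCDF, cdf_eq_real, h, map_measureReal_apply (by fun_prop) measurableSet_Iic]
  congr 1
  ext y
  simp [le_div_iff₀' hσ]

lemma tendsto_measureReal_of_tendstoInDistribution {Ω' : ℕ → Type*} [∀ n, MeasurableSpace (Ω' n)]
    {P' : ∀ n, Measure (Ω' n)} [∀ n, IsProbabilityMeasure (P' n)] {Y : ∀ n, Ω' n → ℝ}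
    {v : NNReal} (hv : v ≠ 0)
    (h : TendstoInDistribution Y atTop (id : ℝ → ℝ) P' (gaussianReal 0 v)) (x : ℝ) :
    Tendsto (fun n => (P' n).real {ω | Y n ω ≤ x}) atTop
      (𝓝 ((gaussianReal 0 v).real (Set.Iic x))) := by
  have := tendsto_measureReal_Iic_of_tendsto h.tendsto x
    (by simpa using gaussianReal_singleton hv x)
  simp only [ProbabilityMeasure.coe_mk, Measure.map_id] at this
  refine this.congr fun n => ?_
  rw [map_measureReal_apply_of_aemeasurable (h.forall_aemeasurable n) measurableSet_Iic]
  rfl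

variable {Ω : Type*} [MeasurableSpace Ω] {μ : Measure Ω}
  {X : ℤ → Ω → ℝ} {t : ∀ m : ℕ, (Fin m → ℝ) → ℝ} {τ : ℕ → ℝ} {θ : ℝ} {b : ℕ → ℕ}

lemma withHighProb_second_moment {v : NNReal}
    (hU : ∀ δ > 0, WithHighProb μ fun n ω => |rescaledError X t τ n (b n) ω θ| < δ)
    (hS : ∀ ε > 0, WithHighProb μ fun n ω =>
      ∀ x, |subDist X t τ n (b n) x ω - (gaussianReal 0 v).real (Set.Iic x)| ≤ ε)
    (hcond : ∀ ε : ℝ, 0 < ε →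
      Tendsto (fun m : ℕ => ⨆ n : ℕ, ⨆ _ : m ≤ n,
        μ {ω | ε < truncSecondMoment X t τ θ n (b n) m ω}) atTop (𝓝 0))
    {ε : ℝ} (hε : 0 < ε) :
    WithHighProb μ fun n ω => |∫ y, y ^ 2 ∂(subLaw X t τ n (b n) ω) - v| ≤ ε := by
  refine withHighProb_of_forall_pos fun η hη => ?_
  obtain ⟨m₀, hm₀⟩ := exists_forall_abs_second_moment_sub_le (v := v) hε
  -- The level `ε / 12` becomes `ε / 3` after the factor 4 lost in removing `U`. The level `m` is
  -- fixed before `n` grows.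
  obtain ⟨m, hm, hm1, hmm⟩ := ((ENNReal.tendsto_nhds_zero.1 (hcond (ε / 12) (by linarith)) (η / 2)
    (ENNReal.half_pos hη.ne')).and ((eventually_ge_atTop 1).and (eventually_ge_atTop m₀))).exists
  obtain ⟨δ, hδ, H⟩ := hm₀ (m + 1) (by omega)
  have hE := ENNReal.tendsto_nhds_zero.1 ((hU 1 one_pos).and (hS δ hδ)) (η / 2)
    (ENNReal.half_pos hη.ne')
  filter_upwards [hE, eventually_ge_atTop m] with n h1 h2
  have h3 : μ {ω | ε / 12 < truncSecondMoment X t τ θ n (b n) m ω} ≤ η / 2 :=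
    (le_iSup₂ (f := fun (n : ℕ) (_ : m ≤ n) =>
      μ {ω | ε / 12 < truncSecondMoment X t τ θ n (b n) m ω}) n h2).trans hm
  rw [← ENNReal.add_halves η]
  refine (measure_mono ?_).trans ((measure_union_le _ _).trans (add_le_add h1 h3))
  intro ω hω
  by_contra hcon
  simp only [Set.mem_union, Set.mem_ofPred_eq, not_or, not_not, not_lt] at hcon
  obtain ⟨⟨c1, c2⟩, c3⟩ := hcon
  refine hω (H ⟨subLaw X t τ n (b n) ω, inferInstance⟩ (integrable_subLaw ..) (fun x => ?_) ?_)
  · rw [ProbabilityMeasure.coe_mk, subLaw_real_Iic]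
    exact c2 x
  · refine (integral_truncated_subLaw_le c1.le hm1).trans ?_
    linarith

lemma withHighProb_subVar_and_convDist {v : NNReal} (hv : v ≠ 0)
    (hS : ∀ ε > 0, WithHighProb μ fun n ω =>
      ∀ x, |subDist X t τ n (b n) x ω - (gaussianReal 0 v).real (Set.Iic x)| ≤ ε)
    (hM : ∀ ε > 0, WithHighProb μ fun n ω =>
      |∫ y, y ^ 2 ∂(subLaw X t τ n (b n) ω) - v| ≤ ε)
    {ε : ℝ} (hε : 0 < ε) :
    WithHighProb μ fun n ω => |subVar X t τ n (b n) ω - v| < ε ∧ ∀ k, 1 ≤ k → ∀ x,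
      |convDist X t τ n (b n) k x ω - (gaussianReal 0 v).real (Set.Iic x)| ≤ ε := by
  -- The cap at 1 gives `subMean ^ 2 ≤ |subMean| ≤ ε / 3`, so the variance is off by at most `2 * ε
  -- / 3`.
  have hε' : 0 < min (ε / 3) 1 := by positivity
  obtain ⟨δ, hδ, H⟩ := exists_forall_normalizedSumLaw_close hv hε'
  refine ((hS δ hδ).and ((hM δ hδ).and (hM (ε / 3) (by linarith)))).mono
    (Eventually.of_forall ?_)
  rintro n ω ⟨h1, h2, h3⟩
  obtain ⟨e1, e2⟩ := H ⟨subLaw X t τ n (b n) ω, inferInstance⟩ (integrable_subLaw ..)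
    (fun x => by rw [ProbabilityMeasure.coe_mk, subLaw_real_Iic]; exact h1 x) h2
  simp only [ProbabilityMeasure.coe_mk, integral_id_subLaw, normalizedSumLaw_subLaw_real_Iic]
    at e1 e2
  have hle : min (ε / 3) 1 ≤ ε / 3 := min_le_left _ _
  have hle1 : min (ε / 3) 1 ≤ 1 := min_le_right _ _
  refine ⟨?_, fun k hk x => (e2 k hk x).trans (by linarith)⟩
  rw [← integral_sq_subLaw_sub]
  have h4 : subMean X t τ n (b n) ω ^ 2 ≤ ε / 3 := by
    rw [← sq_abs]
    nlinarith [abs_nonneg (subMean X t τ n (b n) ω)]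
  rw [abs_le] at h3
  rw [abs_lt]
  constructor <;> linarith [sq_nonneg (subMean X t τ n (b n) ω)]

lemma measurable_blockRoot (hX : ∀ i, Measurable (X i)) (ht : ∀ m, Measurable (t m)) (m i : ℕ) :
    Measurable (blockRoot X t τ θ m i) :=
  (((ht m).comp (measurable_pi_lambda _ fun _ => hX _)).sub_const θ).const_mul _

variable [IsProbabilityMeasure μ]

lemma abs_cov_blockRoot_le (ht : ∀ m, Measurable (t m)) (m K i j : ℕ) (hij : i + (m + K) ≤ j)
    (x : ℝ) :
    |μ.real ({ω | blockRoot X t τ θ m i ω ≤ x} ∩ {ω | blockRoot X t τ θ m j ω ≤ x})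
      - μ.real {ω | blockRoot X t τ θ m i ω ≤ x} * μ.real {ω | blockRoot X t τ θ m j ω ≤ x}|
      ≤ alphaMixing μ X K := by
  have hB : MeasurableSet {z : Fin m → ℝ | τ m * (t m z - θ) ≤ x} :=
    measurableSet_le (((ht m).sub_const θ).const_mul _) measurable_const
  refine abs_measureReal_inter_sub_mul_le_alphaMixing (i := (i : ℤ) + m)
    (measurable_block_pastSigma m i hB) ?_
  exact futureSigma_anti (j := (j : ℤ)) (by omega) _
    (measurable_block_futureSigma m j hB)

/-- Chebyshev's inequality: blocks whose starting times differ by at least `m + K` have covariance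
at most `α(K)`. -/
lemma measureReal_rootEmpDist_ge_le (hX : ∀ i, Measurable (X i)) (ht : ∀ m, Measurable (t m))
    (n m K : ℕ) (x : ℝ) {ε : ℝ} (hε : 0 < ε) :
    μ.real {ω | ¬ |rootEmpDist X t τ n m ω θ x - avgDist μ X t τ θ n m x| < ε}
      ≤ (2 * (m + K) / numBlocks n m + alphaMixing μ X K) / ε ^ 2 := by
  classical
  set N := numBlocks n m with hN
  set A : ℕ → Set Ω := fun i => {ω | blockRoot X t τ θ m i ω ≤ x} with hAdef
  have hA : ∀ i, MeasurableSet (A i) := fun i =>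
    measurableSet_le (measurable_blockRoot hX ht m i) measurable_const
  have hα : 0 ≤ alphaMixing μ X K :=
    (abs_nonneg _).trans (abs_cov_blockRoot_le (θ := θ) (τ := τ) ht m K 0 (m + K) (by omega) x)
  have key := integral_sq_average_indicator_sub_le (μ := μ) hA (N := N) (L := m + K)
    (numBlocks_pos n m) hα fun i j hij => abs_cov_blockRoot_le ht m K i j hij x
  have hZ : ∀ ω, rootEmpDist X t τ n m ω θ x - avgDist μ X t τ θ n m x
      = (N : ℝ)⁻¹ * ∑ i ∈ Finset.Icc 1 N, ((A i).indicator 1 ω - μ.real (A i)) := by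
    intro ω
    rw [rootEmpDist, avgDist, ← mul_sub, ← Finset.sum_sub_distrib]
    congr 1
  simp_rw [hZ, not_lt]
  set Z : Ω → ℝ := fun ω => (N : ℝ)⁻¹ * ∑ i ∈ Finset.Icc 1 N,
    ((A i).indicator 1 ω - μ.real (A i)) with hZdef
  have hind : ∀ i, Measurable ((A i).indicator (1 : Ω → ℝ)) := fun i =>
    measurable_one.indicator (hA i)
  have hZm : Measurable Z := by
    refine Measurable.const_mul (Finset.measurable_fun_sum _ fun i _ => ?_) _
    exact (hind i).sub_const _
  have hZb : ∀ ω, |Z ω| ≤ 1 := by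
    intro ω
    have hNp : (0 : ℝ) < N := by exact_mod_cast numBlocks_pos n m
    rw [hZdef, abs_mul, abs_of_pos (inv_pos.2 hNp), inv_mul_le_iff₀ hNp, mul_one]
    refine (Finset.abs_sum_le_sum_abs _ _).trans ?_
    refine (Finset.sum_le_card_nsmul _ _ 1 fun i _ => ?_).trans (by simp)
    have h1 : μ.real (A i) ≤ 1 := measureReal_le_one
    have h2 : 0 ≤ μ.real (A i) := measureReal_nonneg
    rw [Set.indicator_apply, Pi.one_apply, abs_le]
    split_ifs <;> constructor <;> linarith
  have hZi : Integrable (fun ω => Z ω ^ 2) μ := by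
    refine (integrable_const (1 : ℝ)).mono' (hZm.pow_const 2).aestronglyMeasurable
      (ae_of_all _ fun ω => ?_)
    rw [Real.norm_of_nonneg (sq_nonneg _), ← sq_abs]
    exact pow_le_one₀ (abs_nonneg _) (hZb ω)
  have hcheb := mul_meas_ge_le_integral_of_nonneg (ae_of_all μ fun ω => sq_nonneg (Z ω)) hZi
    (ε ^ 2)
  have hset : {ω | ε ^ 2 ≤ Z ω ^ 2} = {ω | ε ≤ |Z ω|} := by
    ext ω
    change ε ^ 2 ≤ Z ω ^ 2 ↔ ε ≤ |Z ω|
    rw [← sq_abs (Z ω), sq_le_sq₀ hε.le (abs_nonneg _)]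
  rw [hset] at hcheb
  rw [le_div_iff₀' (by positivity)]
  refine (hcheb.trans key).trans (le_of_eq ?_)
  push_cast
  ring

lemma withHighProb_rootEmpDist (hX : ∀ i, Measurable (X i)) (ht : ∀ m, Measurable (t m))
    (hmix : StronglyMixing μ X) (hb : ∀ᶠ n in atTop, b n < n)
    (hbn : Tendsto (fun n => (b n : ℝ) / n) atTop (𝓝 0)) (x : ℝ) {ε : ℝ} (hε : 0 < ε) :
    WithHighProb μ fun n ω =>
      |rootEmpDist X t τ n (b n) ω θ x - avgDist μ X t τ θ n (b n) x| < ε := by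
  refine withHighProb_of_forall_pos fun η hη => ?_
  rcases eq_or_ne η ∞ with rfl | hηtop
  · exact Eventually.of_forall fun _ => le_top
  lift η to NNReal using hηtop
  have hη' : (0 : ℝ) < η := by exact_mod_cast hη
  -- The gap `K` is fixed first to make `α(K)` small; then `(b n + K) / N_n → 0`, as `N_n ≥ n / 2`
  -- once `b n / n < 1 / 2`.
  obtain ⟨K, hK⟩ := (hmix.eventually (gt_mem_nhds (show 0 < η * ε ^ 2 / 2 by positivity))).exists
  have hlim : Tendsto (fun n : ℕ => 4 * ((b n : ℝ) / n + (K : ℝ) / n)) atTop (𝓝 0) := by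
    simpa using (hbn.add (tendsto_const_div_atTop_nhds_zero_nat (K : ℝ))).const_mul 4
  filter_upwards [hb, hlim.eventually (gt_mem_nhds (show 0 < η * ε ^ 2 / 2 by positivity)),
    hbn.eventually (gt_mem_nhds (show (0 : ℝ) < 1 / 2 by norm_num))] with n h1 h2 h3
  have hn : (0 : ℝ) < n := by exact_mod_cast (Nat.zero_le _).trans_lt h1
  have hN : (n : ℝ) / 2 ≤ numBlocks n (b n) := by
    rw [div_lt_iff₀ hn] at h3
    rw [numBlocks]
    push_cast [Nat.cast_sub h1.le]
    linarith
  have h4 : 2 * ((b n : ℝ) + K) / numBlocks n (b n) ≤ 4 * ((b n : ℝ) / n + (K : ℝ) / n) := by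
    calc 2 * ((b n : ℝ) + K) / numBlocks n (b n) ≤ 2 * ((b n : ℝ) + K) / (n / 2) := by gcongr
      _ = 4 * ((b n : ℝ) / n + (K : ℝ) / n) := by field_simp; ring
  have h5 := measureReal_rootEmpDist_ge_le (μ := μ) (τ := τ) (θ := θ) hX ht n (b n) K x hε
  have h6 : (2 * ((b n : ℝ) + K) / numBlocks n (b n) + alphaMixing μ X K) / ε ^ 2 ≤ η := by
    rw [div_le_iff₀ (by positivity)]
    linarith
  rw [← ENNReal.ofReal_coe_nnreal, ← ENNReal.ofReal_toReal (measure_ne_top μ _)]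
  exact ENNReal.ofReal_le_ofReal (h5.trans h6)

lemma withHighProb_subDist (hX : ∀ i, Measurable (X i)) (ht : ∀ m, Measurable (t m))
    (hmix : StronglyMixing μ X) (hb : ∀ᶠ n in atTop, b n < n)
    (hbn : Tendsto (fun n => (b n : ℝ) / n) atTop (𝓝 0))
    (hU : ∀ δ > 0, WithHighProb μ fun n ω => |rescaledError X t τ n (b n) ω θ| < δ)
    {γ : Measure ℝ} [IsProbabilityMeasure γ] (hγ : ∀ x, γ {x} = 0)
    (hD : ∀ x, Tendsto (fun n => avgDist μ X t τ θ n (b n) x) atTop (𝓝 (γ.real (Set.Iic x))))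
    {ε : ℝ} (hε : 0 < ε) :
    WithHighProb μ fun n ω => ∀ x, |subDist X t τ n (b n) x ω - γ.real (Set.Iic x)| ≤ ε := by
  obtain ⟨A, hA⟩ := exists_finset_forall_abs_measureReal_Iic_sub_le γ hγ hε
  have hpt : ∀ a ∈ A, WithHighProb μ fun n ω =>
      |subDist X t τ n (b n) a ω - γ.real (Set.Iic a)| ≤ ε / 2 := by
    intro a _
    -- The sandwich at `a ± δ / 2` costs `ε / 8` each for continuity of the limit, convergence of
    -- `D_{n,b}` and the empirical fluctuation: less than `ε / 2` in all.
    obtain ⟨δ, hδ, hcont⟩ := Metric.continuousAt_iff.1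
      ((continuous_measureReal_Iic γ hγ).continuousAt (x := a)) (ε / 8) (by linarith)
    have c1 := hcont (x := a - δ / 2) (by rw [Real.dist_eq, abs_lt]; constructor <;> linarith)
    have c2 := hcont (x := a + δ / 2) (by rw [Real.dist_eq, abs_lt]; constructor <;> linarith)
    rw [Real.dist_eq, abs_lt] at c1 c2
    have hε8 : 0 < ε / 8 := by linarith
    refine ((hU (δ / 2) (half_pos hδ)).and
      ((withHighProb_rootEmpDist (τ := τ) (θ := θ) hX ht hmix hb hbn (a - δ / 2) hε8).and
        (withHighProb_rootEmpDist (τ := τ) (θ := θ) hX ht hmix hb hbn (a + δ / 2) hε8))).mono ?_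
    filter_upwards [Metric.tendsto_nhds.1 (hD (a - δ / 2)) _ hε8,
      Metric.tendsto_nhds.1 (hD (a + δ / 2)) _ hε8] with n d1 d2 ω ⟨hω, e1, e2⟩
    rw [Real.dist_eq, abs_lt] at d1 d2
    rw [abs_lt] at hω e1 e2
    have s1 := subDist_le_rootEmpDist hω.2.le a
    have s2 := rootEmpDist_le_subDist hω.1.le a
    rw [abs_le]
    constructor <;> linarith
  refine (withHighProb_forall_finset A hpt).mono (Eventually.of_forall fun n ω hω => ?_)
  simp_rw [← subLaw_real_Iic] at hω ⊢
  exact hA _ (fun x y hxy => measureReal_mono (Set.Iic_subset_Iic.2 hxy))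
    (fun _ => measureReal_nonneg) (fun _ => measureReal_le_one) hω

lemma eventually_forall_abs_rootDist_sub_le {v : NNReal} (hv : v ≠ 0)
    (h : TendstoInDistribution (fun n => root X t τ θ n) atTop (id : ℝ → ℝ)
      (fun _ => μ) (gaussianReal 0 v)) {ε : ℝ} (hε : 0 < ε) :
    ∀ᶠ n in atTop, ∀ x, |rootDist μ X t τ θ n x - (gaussianReal 0 v).real (Set.Iic x)| ≤ ε := by
  obtain ⟨A, hA⟩ := exists_finset_forall_abs_measureReal_Iic_sub_le (gaussianReal 0 v)
    (gaussianReal_singleton hv) hε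
  have hev : ∀ᶠ n in atTop, ∀ a ∈ A,
      |rootDist μ X t τ θ n a - (gaussianReal 0 v).real (Set.Iic a)| ≤ ε / 2 := by
    rw [eventually_all_finset]
    intro a _
    have := tendsto_measureReal_of_tendstoInDistribution hv h a
    rw [tendsto_iff_norm_sub_tendsto_zero] at this
    exact (this.eventually (gt_mem_nhds (half_pos hε))).mono fun _ h => h.le
  filter_upwards [hev] with n hn
  exact hA _ (fun x y hxy => measureReal_mono fun ω hω => le_trans hω hxy)
    (fun _ => measureReal_nonneg) (fun _ => measureReal_le_one) hn

end Subsampling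

/-! ### The main theorem. -/

theorem theorem4
    {Ω : Type*} [MeasurableSpace Ω] (μ : Measure Ω) [IsProbabilityMeasure μ]
    -- the process, the statistics `t_m`, the scalings `τ_m`, the parameter `t(P) = θ`
    (X : ℤ → Ω → ℝ) (hX : ∀ i, Measurable (X i))
    (t : ∀ m : ℕ, (Fin m → ℝ) → ℝ) (ht : ∀ m, Measurable (t m))
    (τ : ℕ → ℝ) (hτ : ∀ m, 1 ≤ m → 0 < τ m)
    (θ : ℝ)
    -- the block lengths
    (b : ℕ → ℕ) (hb : ∀ n, 2 ≤ n → 1 ≤ b n ∧ b n < n)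
    (σ : ℝ) (hσ : 0 < σ)
    (hmix : Subsampling.StronglyMixing μ X)
    (hblock : Tendsto (fun n => (b n : ℝ)⁻¹ + (b n : ℝ) / (n : ℝ) + τ (b n) / τ n) atTop (𝓝 0))
    -- `T_n = o_p(τ_n / τ_b)`
    (hTop : TendstoInMeasure μ
      (fun n ω => Subsampling.root X t τ θ n ω / (τ n / τ (b n))) atTop (fun _ => 0))
    -- the truncated second moment condition
    (hcond : ∀ ε : ℝ, 0 < ε →
      Tendsto (fun m : ℕ => ⨆ n : ℕ, ⨆ _ : m ≤ n,
        μ {ω | ε < Subsampling.truncSecondMoment X t τ θ n (b n) m ω}) atTop (𝓝 0))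
    -- `Y_b` has distribution function `D_{n,b}` and converges in distribution to `N(0, σ²)`
    {Ω' : ℕ → Type*} [∀ n, MeasurableSpace (Ω' n)] (P' : ∀ n, Measure (Ω' n))
    [∀ n, IsProbabilityMeasure (P' n)] (Y : ∀ n, Ω' n → ℝ)
    (hY : ∀ n, 2 ≤ n → ∀ x : ℝ,
      (P' n).real {ω | Y n ω ≤ x} = Subsampling.avgDist μ X t τ θ n (b n) x)
    (hYlim : TendstoInDistribution Y atTop (id : ℝ → ℝ) P' (gaussianReal 0 (σ ^ 2).toNNReal)) :
    TendstoInMeasure μ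
      (fun n ω => ⨆ x : ℝ,
        |Subsampling.subDist X t τ n (b n) x ω - Subsampling.stdNormalCDF (x / σ)|)
      atTop (fun _ => 0) ∧
    TendstoInMeasure μ
      (fun n ω => Subsampling.subVar X t τ n (b n) ω) atTop (fun _ => σ ^ 2) ∧
    (∀ k : ℕ → ℕ, (∀ n, 1 ≤ k n) →
      TendstoInMeasure μ
        (fun n ω => ⨆ x : ℝ,
          |Subsampling.convDist X t τ n (b n) (k n) x ω - Subsampling.stdNormalCDF (x / σ)|)
        atTop (fun _ => 0)) ∧
    (TendstoInDistribution (fun n => Subsampling.root X t τ θ n) atTop (id : ℝ → ℝ)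
        (fun _ => μ) (gaussianReal 0 (σ ^ 2).toNNReal) →
      TendstoInMeasure μ
        (fun n ω => ⨆ x : ℝ,
          |Subsampling.subDist X t τ n (b n) x ω - Subsampling.rootDist μ X t τ θ n x|)
        atTop (fun _ => 0) ∧
      ∀ k : ℕ → ℕ, (∀ n, 1 ≤ k n) →
        TendstoInMeasure μ
          (fun n ω => ⨆ x : ℝ,
            |Subsampling.convDist X t τ n (b n) (k n) x ω - Subsampling.rootDist μ X t τ θ n x|)
          atTop (fun _ => 0)) := by
  set v : NNReal := (σ ^ 2).toNNReal with hvdef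
  have hvσ : (v : ℝ) = σ ^ 2 := Real.coe_toNNReal _ (sq_nonneg σ)
  have hv : v ≠ 0 := by
    intro h
    rw [h, NNReal.coe_zero] at hvσ
    exact (pow_pos hσ 2).ne hvσ
  have hb' : ∀ᶠ n in atTop, b n < n :=
    (eventually_ge_atTop 2).mono fun n hn => (hb n hn).2
  have hbn : Tendsto (fun n => (b n : ℝ) / n) atTop (𝓝 0) := by
    refine tendsto_of_tendsto_of_tendsto_of_le_of_le' tendsto_const_nhds hblock
      (Eventually.of_forall fun n => by positivity) ?_
    filter_upwards [eventually_ge_atTop 2] with n hn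
    have h1 : 0 ≤ τ (b n) / τ n := (div_pos (hτ _ (hb n hn).1) (hτ n (by omega))).le
    have h2 : (0 : ℝ) ≤ (b n : ℝ)⁻¹ := by positivity
    linarith
  -- `U = T_n / (τ_n / τ_b)` once `n ≥ 2`, where both scalings are nonzero.
  have hU : ∀ δ > 0, Subsampling.WithHighProb μ fun n ω =>
      |Subsampling.rescaledError X t τ n (b n) ω θ| < δ := by
    intro δ hδ
    refine (Subsampling.tendstoInMeasure_iff_withHighProb.1 hTop δ hδ).mono ?_
    filter_upwards [eventually_ge_atTop 2] with n hn ω hω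
    have h1 := (hτ _ (hb n hn).1).ne'
    have h2 := (hτ n (by omega)).ne'
    convert hω using 2
    simp only [Subsampling.rescaledError, Subsampling.root, Subsampling.blockRoot]
    field_simp
    ring
  have hD : ∀ x, Tendsto (fun n => Subsampling.avgDist μ X t τ θ n (b n) x) atTop
      (𝓝 ((gaussianReal 0 v).real (Set.Iic x))) := by
    intro x
    refine (Subsampling.tendsto_measureReal_of_tendstoInDistribution hv hYlim x).congr' ?_
    filter_upwards [eventually_ge_atTop 2] with n hn
    exact hY n hn x
  have hS : ∀ ε > 0, Subsampling.WithHighProb μ fun n ω => ∀ x,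
      |Subsampling.subDist X t τ n (b n) x ω - (gaussianReal 0 v).real (Set.Iic x)| ≤ ε :=
    fun ε hε => Subsampling.withHighProb_subDist hX ht hmix hb' hbn hU
      (Subsampling.gaussianReal_singleton hv) hD hε
  -- The event controls all `k ≥ 1` at once, hence any sequence `k n`.
  have hC : ∀ ε > 0, Subsampling.WithHighProb μ fun n ω =>
      |Subsampling.subVar X t τ n (b n) ω - v| < ε ∧ ∀ k, 1 ≤ k → ∀ x,
        |Subsampling.convDist X t τ n (b n) k x ω - (gaussianReal 0 v).real (Set.Iic x)| ≤ ε :=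
    fun ε hε => Subsampling.withHighProb_subVar_and_convDist hv hS
      (fun ε hε => Subsampling.withHighProb_second_moment hU hS hcond hε) hε
  simp_rw [Subsampling.stdNormalCDF_div hσ]
  refine ⟨Subsampling.tendstoInMeasure_iSup hS, ?_, fun k hk => ?_,
    fun hroot => ⟨?_, fun k hk => ?_⟩⟩
  · rw [Subsampling.tendstoInMeasure_iff_withHighProb]
    intro ε hε
    refine (hC ε hε).mono (Eventually.of_forall fun n ω hω => ?_)
    rw [← hvσ]
    exact hω.1
  · exact Subsampling.tendstoInMeasure_iSup fun ε hε =>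
      (hC ε hε).mono (Eventually.of_forall fun n ω hω => hω.2 (k n) (hk n))
  · refine Subsampling.tendstoInMeasure_iSup fun ε hε => (hS _ (half_pos hε)).mono ?_
    filter_upwards [Subsampling.eventually_forall_abs_rootDist_sub_le hv hroot (half_pos hε)]
      with n hn ω hω x
    have h1 := abs_le.1 (hn x)
    have h2 := abs_le.1 (hω x)
    rw [abs_le]
    constructor <;> linarith
  · refine Subsampling.tendstoInMeasure_iSup fun ε hε => (hC _ (half_pos hε)).mono ?_
    filter_upwards [Subsampling.eventually_forall_abs_rootDist_sub_le hv hroot (half_pos hε)]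
      with n hn ω hω x
    have h1 := abs_le.1 (hn x)
    have h2 := abs_le.1 (hω.2 (k n) (hk n) x)
    rw [abs_le]
    constructor <;> linarith
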